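/- Conventions. Let $A$ be a real $n\times d$ matrix with rows $a_1,\dots,a_n\in\mathbb R^d$ and let $1\le k\le d$. For $T\subseteq[n]$, $A_T$ is the submatrix of the rows in $T$, and $A_{1:i}$ consists of the first $i$ rows. $\|\cdot\|_2$ is the operator norm, $\|\cdot\|_F$ the Frobenius norm, $[M]_k$ a best approximation of $M$ of rank at most $k$ in Frobenius norm, $M^+$ the Moore–Penrose pseudoinverse, $\sigma_{\min}(M)$ the smallest non-zero singular value of $M\neq 0$, and $d(a,V)=\min_{v\in V}\|a-v\|_2$ the Euclidean distance. Online rank-$k$ condition number. For $A\ne 0$ let $i^*$ be the largest $i\le n$ with $\operatorname{rank}(A_{1:i})\le k$ (if $\operatorname{rank}(A)\ge k$, this is the largest $i$ with $\operatorname{rank}(A_{1:i})=k$). Put $$\kappa=\frac{\|A\|_2}{\min\{\sigma_{\min}(A_{1:i}) : i\le\min(i^*+1,n),\ A_{1:i}\neq 0\}}.$$ Algorithm. The rows $a_1,\dots,a_n$ arrive as a stream. Start with $S=\emptyset$ and $\lambda=0$. For $t=1,\dots,n$: if $\lambda=0$ and $a_t\notin\operatorname{rowspace}(A_S)$, add $t$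 to $S$; otherwise, if $a_t^{\mathsf T}(A_S^{\mathsf T}A_S+\lambda I)^+a_t\ge \frac1{1+1/k}$, add $t$ to $S$; then set $\lambda=\|A_S-[A_S]_k\|_F^2/k$. Return $S$. Between reading the rows the algorithm keeps only the rows of $A_S$ with their indices and the number $\lambda$; while a row is processed it also holds that row. Its space at a given moment is the number of words held in this way (one word per real number or index), so that one row takes $d$ words. Theorem. There is a universal constant $C>0$ such that for all $n\ge2$, all $1\le k\le d$ and every non-zero real $n\times d$ matrix $A$ with online rank-$k$ condition number $\kappa$, the set $S$ returned by the algorithm is non-empty and satisfies: 1. $|S|\le C\,k\,(\log(n\kappa))^2$. 2. For every $k$-dimensional subspace $V\subseteq\mathbb R^d$, $$\max_{i\in S}d(a_i,V)\ \le\ \max_{i\in[n]}d(a_i,V)\ \le\ C\sqrt k\,\log(n\kappa)\,\max_{i\in S}d(a_i,V);$$ that is, $1\le \max_{i\in[n]}d(a_i,V)/\max_{i\in S}d(a_i,V)\le C\sqrt k\log(n\kappa)$ whenever the denominator is non-zero, and both maxima vanish otherwise. 3. At every moment of the run the space used by the algorithm is at most $C\,|S|\,d$ words, i.e. the space needed to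 store $O(|S|)$ rows of $A$. -/

import Mathlib

namespace RidgeCoreset

/-- `A_{1:i}`: the first `i` rows of `A`. -/
def firstRows {n d : ℕ} (A : Matrix (Fin n) (Fin d) ℝ) (i : ℕ) :
    Matrix {j : Fin n // (j : ℕ) < i} (Fin d) ℝ :=
  A.submatrix Subtype.val id

/-- The linear span of the rows of a matrix. -/
def rowspace {m : Type*} {d : ℕ} (M : Matrix m (Fin d) ℝ) : Submodule ℝ (Fin d → ℝ) :=
  Submodule.span ℝ (Set.range M.row)

/-- Squared Frobenius norm. -/
def frobSq {m : Type*} [Fintype m] {d : ℕ} (M : Matrix m (Fin d) ℝ) : ℝ :=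
  ∑ i, ∑ j, M i j ^ 2

/-- `‖M - [M]_k‖_F²`: the least squared Frobenius distance from `M` to a matrix of rank at
most `k`. -/
noncomputable def tailSq {m : Type*} [Fintype m] {d : ℕ} (k : ℕ) (M : Matrix m (Fin d) ℝ) : ℝ :=
  sInf {e : ℝ | ∃ X : Matrix m (Fin d) ℝ, X.rank ≤ k ∧ e = frobSq (M - X)}

/-- `P` is the Moore–Penrose pseudoinverse of the real square matrix `M`. -/
structure IsMoorePenrose {d : ℕ} (M P : Matrix (Fin d) (Fin d) ℝ) : Prop where
  mul_mul_left : M * P * M = M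
  mul_mul_right : P * M * P = P
  symm_left : (M * P).transpose = M * P
  symm_right : (P * M).transpose = P * M

theorem IsMoorePenrose.unique {d : ℕ} {M P Q : Matrix (Fin d) (Fin d) ℝ}
    (hP : IsMoorePenrose M P) (hQ : IsMoorePenrose M Q) : P = Q := by
  have h1 : M * P = M * Q := by
    have h : M * P = (M * Q) * (M * P) := by
      rw [← Matrix.mul_assoc, hQ.mul_mul_left]
    rw [h, ← hQ.symm_left, ← hP.symm_left, ← Matrix.transpose_mul, ← Matrix.mul_assoc,
      hP.mul_mul_left]
  have h2 : P * M = Q * M := by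
    have h : P * M = (P * M) * (Q * M) := by
      rw [Matrix.mul_assoc, ← Matrix.mul_assoc M Q M, hQ.mul_mul_left]
    rw [h, ← hQ.symm_right, ← hP.symm_right, ← Matrix.transpose_mul, Matrix.mul_assoc,
      ← Matrix.mul_assoc M P M, hP.mul_mul_left]
  rw [← hP.mul_mul_right, ← hQ.mul_mul_right, h2, Matrix.mul_assoc, Matrix.mul_assoc, h1]

theorem exists_isMoorePenrose {d : ℕ} {M : Matrix (Fin d) (Fin d) ℝ} (hM : M.IsHermitian) :
    ∃ P, IsMoorePenrose M P := by
  have hs : IsSelfAdjoint M := hM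
  have hc : ∀ f : ℝ → ℝ, ContinuousOn f (spectrum ℝ M) := fun f =>
    (Matrix.finite_real_spectrum (A := M)).continuousOn f
  have hid : cfc (fun x : ℝ => x) M = M := cfc_id' ℝ M
  have hMP : M * cfc (fun x : ℝ => x⁻¹) M = cfc (fun x : ℝ => x * x⁻¹) M := by
    rw [cfc_mul (fun x : ℝ => x) (fun x : ℝ => x⁻¹) M (hc _) (hc _), hid]
  have hPM : cfc (fun x : ℝ => x⁻¹) M * M = cfc (fun x : ℝ => x⁻¹ * x) M := by
    rw [cfc_mul (fun x : ℝ => x⁻¹) (fun x : ℝ => x) M (hc _) (hc _), hid]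
  have hsym : ∀ f : ℝ → ℝ, (cfc f M).transpose = cfc f M := fun f => by
    have h : IsSelfAdjoint (cfc f M) := cfc_predicate f M
    rw [← Matrix.conjTranspose_eq_transpose_of_trivial]
    exact h
  refine ⟨cfc (fun x : ℝ => x⁻¹) M, ?_, ?_, ?_, ?_⟩
  · rw [hMP]
    have : cfc (fun x : ℝ => x * x⁻¹) M * M = cfc (fun x : ℝ => x * x⁻¹ * x) M := by
      rw [cfc_mul (fun x : ℝ => x * x⁻¹) (fun x : ℝ => x) M (hc _) (hc _), hid]
    rw [this]
    simp only [mul_inv_mul_cancel]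
    exact hid
  · rw [hPM, ← cfc_mul (fun x : ℝ => x⁻¹ * x) (fun x : ℝ => x⁻¹) M (hc _) (hc _)]
    congr 1
    funext x
    by_cases hx : x = 0 <;> simp [hx]
  · rw [hMP, hsym]
  · rw [hPM, hsym]

open Classical in
/-- The Moore–Penrose pseudoinverse (it exists and is unique for every symmetric matrix). -/
noncomputable def pinv {d : ℕ} (M : Matrix (Fin d) (Fin d) ℝ) : Matrix (Fin d) (Fin d) ℝ :=
  if h : ∃ P, IsMoorePenrose M P then h.choose else 0

theorem isMoorePenrose_pinv {d : ℕ} {M : Matrix (Fin d) (Fin d) ℝ} (hM : M.IsHermitian) :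
    IsMoorePenrose M (pinv M) := by
  have h := exists_isMoorePenrose hM
  rw [pinv, dif_pos h]
  exact h.choose_spec

/-- `aᵀ (Mᵀ M + lam I)⁺ a`. -/
noncomputable def ridgeScore {m : Type*} [Fintype m] {d : ℕ} (M : Matrix m (Fin d) ℝ) (lam : ℝ)
    (a : Fin d → ℝ) : ℝ :=
  a ⬝ᵥ (pinv (M.transpose * M + lam • (1 : Matrix (Fin d) (Fin d) ℝ))).mulVec a

/-! ### The streaming algorithm -/

/-- Everything the algorithm remembers while it reads the stream: the selected rows with their
labels, the current ridge parameter, and possibly the one row that is being processed. -/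
structure Memory (n d : ℕ) where
  stored : List (Fin n × (Fin d → ℝ))
  ridge : ℝ
  buffer : Option (Fin n × (Fin d → ℝ))

/-- Number of words in use: one for a label, one for each coordinate of a row, one for the ridge
parameter. -/
def Memory.words {n d : ℕ} (m : Memory n d) : ℕ :=
  m.stored.length * (d + 1) + 1 + m.buffer.elim 0 (fun _ => d + 1)

/-- `A_S`, the matrix whose rows are the stored rows. -/
def Memory.matrix {n d : ℕ} (m : Memory n d) : Matrix (Fin m.stored.length) (Fin d) ℝ :=
  Matrix.of fun i => (m.stored.get i).2

/-- `read x` loads the next row of the stream, `select` decides whether the loaded row is kept,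
`update` recomputes the ridge parameter and discards the loaded row. -/
inductive Instr (n d : ℕ) where
  | read (x : Fin n × (Fin d → ℝ)) : Instr n d
  | select : Instr n d
  | update : Instr n d

open Classical in
noncomputable def exec (k : ℕ) {n d : ℕ} (m : Memory n d) : Instr n d → Memory n d
  | .read x => { m with buffer := some x }
  | .select =>
      match m.buffer with
      | none => m
      | some x =>
          if m.ridge = 0 ∧ x.2 ∉ rowspace m.matrix then
            { m with stored := m.stored ++ [x] }
          else if 1 / (1 + 1 / (k : ℝ)) ≤ ridgeScore m.matrix m.ridge x.2 then
            { m with stored := m.stored ++ [x] }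
          else m
  | .update => { m with ridge := tailSq k m.matrix / k, buffer := none }

/-- The three instructions, performed once for each row of `A` in the order of arrival. -/
def program {n d : ℕ} (A : Matrix (Fin n) (Fin d) ℝ) : List (Instr n d) :=
  (List.ofFn fun t : Fin n => [Instr.read (t, A t), Instr.select, Instr.update]).flatten

/-- `S = ∅`, `λ = 0`. -/
def Memory.init (n d : ℕ) : Memory n d := ⟨[], 0, none⟩

/-- All memory contents during the run on the rows of `A`. -/
noncomputable def trace (k : ℕ) {n d : ℕ} (A : Matrix (Fin n) (Fin d) ℝ) : List (Memory n d) :=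
  (program A).scanl (exec k) (Memory.init n d)

/-- The set `S` of labels of the rows stored at the end of the run. -/
noncomputable def selected (k : ℕ) {n d : ℕ} (A : Matrix (Fin n) (Fin d) ℝ) : Finset (Fin n) :=
  (((program A).foldl (exec k) (Memory.init n d)).stored.map Prod.fst).toFinset

/-! ### The online rank-`k` condition number -/

/-- The smallest non-zero singular value (meaningful for a non-zero matrix). -/
noncomputable def sigmaMin {m : Type*} [Fintype m] {d : ℕ} (M : Matrix m (Fin d) ℝ) : ℝ :=
  sInf {s : ℝ | s ≠ 0 ∧ ∃ i : ℕ, s = (Matrix.toEuclideanLin M).singularValues i}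

/-- The largest `i ≤ n` with `rank A_{1:i} ≤ k`. If `k ≤ rank A`, this is the largest `i` with
`rank A_{1:i} = k`, see `rank_firstRows_lastIndex`; if `rank A < k`, it is `n`. -/
noncomputable def lastIndex (k : ℕ) {n d : ℕ} (A : Matrix (Fin n) (Fin d) ℝ) : ℕ :=
  open Classical in Nat.findGreatest (fun i => (firstRows A i).rank ≤ k) n

theorem rank_firstRows_succ_le {n d : ℕ} (A : Matrix (Fin n) (Fin d) ℝ) (i : ℕ) :
    (firstRows A (i + 1)).rank ≤ (firstRows A i).rank + 1 := by
  classical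
  by_cases hi : i < n
  · rw [Matrix.rank_eq_finrank_span_row, Matrix.rank_eq_finrank_span_row]
    have hle : Submodule.span ℝ (Set.range (firstRows A (i + 1)).row) ≤
        Submodule.span ℝ (Set.range (firstRows A i).row) ⊔ Submodule.span ℝ {A ⟨i, hi⟩} := by
      rw [Submodule.span_le]
      rintro _ ⟨⟨j, hj⟩, rfl⟩
      rcases Nat.lt_succ_iff_lt_or_eq.mp hj with h | h
      · exact Submodule.mem_sup_left (Submodule.subset_span ⟨⟨j, h⟩, rfl⟩)
      · refine Submodule.mem_sup_right (Submodule.subset_span ?_)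
        have : j = ⟨i, hi⟩ := Fin.ext h
        subst this
        rfl
    refine (Submodule.finrank_mono hle).trans ((Submodule.finrank_add_le_finrank_add_finrank _ _).trans ?_)
    exact Nat.add_le_add_left ((finrank_span_le_card _).trans (by simp)) _
  · rw [Matrix.rank_eq_finrank_span_row, Matrix.rank_eq_finrank_span_row]
    refine (Submodule.finrank_mono (Submodule.span_mono ?_)).trans (Nat.le_succ _)
    rintro _ ⟨⟨j, hj⟩, rfl⟩
    exact ⟨⟨j, by omega⟩, rfl⟩

theorem rank_firstRows_lastIndex (k : ℕ) {n d : ℕ} (A : Matrix (Fin n) (Fin d) ℝ)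
    (hk : k ≤ A.rank) : (firstRows A (lastIndex k A)).rank = k := by
  classical
  have hP0 : (firstRows A 0).rank ≤ k :=
    (Matrix.rank_le_card_height _).trans (by simp)
  have hle : (firstRows A (lastIndex k A)).rank ≤ k := by
    unfold lastIndex
    exact Nat.findGreatest_spec (P := fun i => (firstRows A i).rank ≤ k) (Nat.zero_le n) hP0
  have hn : lastIndex k A ≤ n := Nat.findGreatest_le n
  refine le_antisymm hle ?_
  rcases hn.eq_or_lt with h | h
  · rw [h]
    have hr : (firstRows A n).rank = A.rank := by
      have hrange : Set.range (firstRows A n).row = Set.range A.row := by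
        ext x
        exact ⟨fun ⟨j, hj⟩ => ⟨j.1, hj⟩, fun ⟨j, hj⟩ => ⟨⟨j, j.2⟩, hj⟩⟩
      rw [Matrix.rank_eq_finrank_span_row, Matrix.rank_eq_finrank_span_row, hrange]
    rw [hr]
    exact hk
  · have hgt : ¬ (firstRows A (lastIndex k A + 1)).rank ≤ k := by
      refine Nat.findGreatest_is_greatest (P := fun i => (firstRows A i).rank ≤ k) (n := n) ?_ h
      exact Nat.lt_succ_self _
    have := rank_firstRows_succ_le A (lastIndex k A)
    omega

open scoped Matrix.Norms.L2Operator in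
/-- `κ = ‖A‖₂ / min σ_min(A_{1:i})`, the minimum over the `i ≤ lastIndex + 1` (and `i ≤ n`) for
which `A_{1:i}` has a non-zero singular value, that is, `A_{1:i} ≠ 0`. -/
noncomputable def onlineCond (k : ℕ) {n d : ℕ} (A : Matrix (Fin n) (Fin d) ℝ) : ℝ :=
  ‖A‖ / sInf {s : ℝ | ∃ i : ℕ, i ≤ n ∧ i ≤ lastIndex k A + 1 ∧ firstRows A i ≠ 0 ∧
    s = sigmaMin (firstRows A i)}

/-- `max_{i ∈ S} d(a_i, V)`, with the Euclidean distance. -/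
noncomputable def maxDist {n d : ℕ} (A : Matrix (Fin n) (Fin d) ℝ) (S : Finset (Fin n))
    (V : Submodule ℝ (EuclideanSpace ℝ (Fin d))) : ℝ :=
  ⨆ i : S, Metric.infDist (WithLp.toLp 2 (A i) : EuclideanSpace ℝ (Fin d)) V

end RidgeCoreset

namespace RidgeCoreset

open Matrix

/-! ### Quadratic forms, pseudoinverses and Frobenius tails -/

section LinearAlgebra

variable {m : Type*} [Fintype m] {d : ℕ}

/-! Everything is read off from the quadratic forms `x ↦ ‖A_S x‖² + λ‖x‖²`.

Covering. A rejected row `a` has ridge score below 1, so Cauchy–Schwarz in the ridge form gives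
`(a·x)² ≤ ‖A_S x‖² + λ‖x‖²` for all `x`; a selected row satisfies this trivially once it is in `S`
(`sq_dotProduct_le_kept`). Let `D` be the largest distance of a selected row from `V`, and take for
`x` the residual `u` of `a` off `V`. Then `a·u = ‖u‖²`, each selected row contributes at most
`D²‖u‖²`, and `λ ≤ |S| D²` because projecting the selected rows onto `V` is a competitor of rank at
most `k`. Hence `‖u‖² ≤ 2|S|D²` (`infDist_sq_le`), and the distance bound follows from the bound on
`|S|`.

Counting. The potential is `log det(I + Λ⁻¹ A_SᵀA_S)`. A selected row whose ridge parameter is at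
least `Λ` multiplies the determinant by at least `5/4` (`card_filter_kept_mul_le`). Conversely the
potential is at most `k log(1 + ‖A‖²/Λ) + ‖A_S - [A_S]_k‖_F²/Λ` (`log_det_one_add_smul_gram_le`),
and the last term is at most `2k` while `λ ≤ 2Λ`. So each dyadic range of `λ` accounts for `O(k
log(nκ))` selections (`card_epoch_mul_le`), and there are `O(log(nκ))` ranges.

The condition number bounds `λ` from below. Once the prefix rank exceeds `k`, `λ ≥ σ²/n²`
(`le_ridgeAt`), where `σ` is the minimum in the definition of `κ`. Before that `λ = 0`, but the
witnesses for selection lie in row spaces of prefixes, where `σ` controls their length; hence `λ`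
may be replaced by `max(λ, σ²/n²)` at the cost of a constant (`exists_witness_of_accepts`).

The space bound holds because the stored list never shrinks. -/

theorem dotProduct_gram_mulVec (M : Matrix m (Fin d) ℝ) (x y : Fin d → ℝ) :
    x ⬝ᵥ ((Mᵀ * M) *ᵥ y) = (M *ᵥ x) ⬝ᵥ (M *ᵥ y) := by
  rw [← mulVec_mulVec, dotProduct_mulVec, vecMul_transpose]

theorem dotProduct_ridge_mulVec (M : Matrix m (Fin d) ℝ) (lam : ℝ) (x y : Fin d → ℝ) :
    x ⬝ᵥ ((Mᵀ * M + lam • (1 : Matrix (Fin d) (Fin d) ℝ)) *ᵥ y) =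
      (M *ᵥ x) ⬝ᵥ (M *ᵥ y) + lam * (x ⬝ᵥ y) := by
  rw [add_mulVec, dotProduct_add, dotProduct_gram_mulVec, smul_mulVec, one_mulVec,
    dotProduct_smul, smul_eq_mul]

theorem isHermitian_ridge (M : Matrix m (Fin d) ℝ) (lam : ℝ) :
    (Mᵀ * M + lam • (1 : Matrix (Fin d) (Fin d) ℝ)).IsHermitian := by
  rw [IsHermitian, conjTranspose_eq_transpose_of_trivial]
  simp

theorem transpose_eq_of_isHermitian {N : Matrix (Fin d) (Fin d) ℝ} (hN : N.IsHermitian) :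
    Nᵀ = N := by
  rw [← conjTranspose_eq_transpose_of_trivial]; exact hN

theorem transpose_pinv {N : Matrix (Fin d) (Fin d) ℝ} (hN : N.IsHermitian) :
    (pinv N)ᵀ = pinv N := by
  have h := isMoorePenrose_pinv hN
  have hT := transpose_eq_of_isHermitian hN
  have e1 : N * (pinv N)ᵀ = (pinv N * N)ᵀ := by rw [transpose_mul, hT]
  have e2 : (pinv N)ᵀ * N = (N * pinv N)ᵀ := by rw [transpose_mul, hT]
  refine IsMoorePenrose.unique (M := N) ⟨?_, ?_, ?_, ?_⟩ h
  · have := congrArg transpose h.mul_mul_left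
    simpa [transpose_mul, hT, Matrix.mul_assoc] using this
  · have := congrArg transpose h.mul_mul_right
    simpa [transpose_mul, hT, Matrix.mul_assoc] using this
  · rw [e1, transpose_transpose, h.symm_right]
  · rw [e2, transpose_transpose, h.symm_left]

theorem mul_mul_pinv {N : Matrix (Fin d) (Fin d) ℝ} (hN : N.IsHermitian) :
    N * N * pinv N = N := by
  have h := isMoorePenrose_pinv hN
  have := congrArg transpose h.mul_mul_left
  rwa [transpose_mul, h.symm_left, transpose_eq_of_isHermitian hN, ← Matrix.mul_assoc] at this

/-- Cauchy–Schwarz for a form that may be degenerate: the discriminant of `t ↦ (x + t y)ᵀ N (x + t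
y)` is nonpositive. -/
theorem dotProduct_mulVec_sq_le {N : Matrix (Fin d) (Fin d) ℝ} (hN : N.IsHermitian)
    (h0 : ∀ x, 0 ≤ x ⬝ᵥ (N *ᵥ x)) (x y : Fin d → ℝ) :
    (y ⬝ᵥ (N *ᵥ x)) ^ 2 ≤ (y ⬝ᵥ (N *ᵥ y)) * (x ⬝ᵥ (N *ᵥ x)) := by
  have hs : x ⬝ᵥ (N *ᵥ y) = y ⬝ᵥ (N *ᵥ x) := by
    rw [dotProduct_mulVec, ← mulVec_transpose, transpose_eq_of_isHermitian hN, dotProduct_comm]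
  have h := discrim_le_zero (a := y ⬝ᵥ (N *ᵥ y)) (b := 2 * (y ⬝ᵥ (N *ᵥ x)))
    (c := x ⬝ᵥ (N *ᵥ x)) (fun t => by
      have := h0 (x + t • y)
      simp only [mulVec_add, mulVec_smul, dotProduct_add, add_dotProduct, smul_dotProduct,
        dotProduct_smul, smul_eq_mul, hs] at this
      linarith)
  rw [discrim] at h
  linarith

theorem dotProduct_self_nonneg' (x : Fin d → ℝ) : 0 ≤ x ⬝ᵥ x :=
  Finset.sum_nonneg fun i _ => mul_self_nonneg (x i)

theorem mulVec_dotProduct_self_nonneg (M : Matrix m (Fin d) ℝ) (x : Fin d → ℝ) :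
    0 ≤ (M *ᵥ x) ⬝ᵥ (M *ᵥ x) :=
  Finset.sum_nonneg fun _ _ => mul_self_nonneg _

omit [Fintype m] in
theorem dotProduct_eq_zero_of_mem_rowspace {M : Matrix m (Fin d) ℝ} {w v : Fin d → ℝ}
    (hw : w ∈ rowspace M) (hv : M *ᵥ v = 0) : w ⬝ᵥ v = 0 := by
  induction hw using Submodule.span_induction with
  | mem x hx =>
    obtain ⟨i, rfl⟩ := hx
    exact congrFun hv i
  | zero => simp
  | add x y _ _ hx hy => rw [add_dotProduct, hx, hy, add_zero]
  | smul c x _ hx => rw [smul_dotProduct, hx, smul_zero]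

theorem transpose_mulVec_mem_rowspace (M : Matrix m (Fin d) ℝ) (y : m → ℝ) :
    Mᵀ *ᵥ y ∈ rowspace M := by
  rw [mulVec_transpose, vecMul_eq_sum]
  exact Submodule.sum_mem _ fun i _ => Submodule.smul_mem _ _ (Submodule.subset_span ⟨i, rfl⟩)

theorem gram_mulVec_eq_zero {M : Matrix m (Fin d) ℝ} {v : Fin d → ℝ}
    (h : (Mᵀ * M) *ᵥ v = 0) : M *ᵥ v = 0 := by
  have := dotProduct_gram_mulVec M v v
  rw [h, dotProduct_zero] at this
  exact dotProduct_self_eq_zero.1 this.symm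

/-- A row of small ridge leverage score is dominated by the regularised Gram form. -/
theorem sq_dotProduct_le_of_ridgeScore_le {M : Matrix m (Fin d) ℝ} {lam : ℝ} {a : Fin d → ℝ}
    (h : 0 < lam ∨ (lam = 0 ∧ a ∈ rowspace M)) (hs : ridgeScore M lam a ≤ 1) (x : Fin d → ℝ) :
    (a ⬝ᵥ x) ^ 2 ≤ (M *ᵥ x) ⬝ᵥ (M *ᵥ x) + lam * (x ⬝ᵥ x) := by
  have hl : 0 ≤ lam := h.elim le_of_lt fun h => h.1.ge
  have hNh := isHermitian_ridge M lam
  set N := Mᵀ * M + lam • (1 : Matrix (Fin d) (Fin d) ℝ) with hN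
  have h0 : ∀ x, 0 ≤ x ⬝ᵥ (N *ᵥ x) := fun x => by
    rw [hN, dotProduct_ridge_mulVec]
    have := mulVec_dotProduct_self_nonneg M x
    have := mul_nonneg hl (dotProduct_self_nonneg' x)
    positivity
  -- The residual is killed by `N`. If `lam > 0` the form is definite; if `lam = 0` the residual
  -- lies in the row space and in the kernel of `M`, so it is orthogonal to itself.
  have hv : a - N *ᵥ (pinv N *ᵥ a) = 0 := by
    set v := a - N *ᵥ (pinv N *ᵥ a) with hv
    have hNv : N *ᵥ v = 0 := by
      rw [hv, mulVec_sub, mulVec_mulVec, mulVec_mulVec, mul_mul_pinv hNh, sub_self]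
    have hq := dotProduct_ridge_mulVec M lam v v
    rw [← hN, hNv, dotProduct_zero] at hq
    rcases h with h | ⟨h, ha⟩
    · have h1 := mulVec_dotProduct_self_nonneg M v
      have h2 := dotProduct_self_nonneg' v
      exact dotProduct_self_eq_zero.1 (by nlinarith)
    · rw [h, zero_mul, add_zero] at hq
      have hMv : M *ᵥ v = 0 := dotProduct_self_eq_zero.1 hq.symm
      refine dotProduct_self_eq_zero.1 (dotProduct_eq_zero_of_mem_rowspace ?_ hMv)
      refine Submodule.sub_mem _ ha ?_
      rw [hN, h, zero_smul, add_zero, ← mulVec_mulVec]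
      exact transpose_mulVec_mem_rowspace _ _
  have ha : a = N *ᵥ (pinv N *ᵥ a) := sub_eq_zero.1 hv
  have hax : a ⬝ᵥ x = (pinv N *ᵥ a) ⬝ᵥ (N *ᵥ x) := by
    conv_lhs => rw [ha]
    rw [dotProduct_mulVec, ← mulVec_transpose, transpose_eq_of_isHermitian hNh]
  have hτ : (pinv N *ᵥ a) ⬝ᵥ (N *ᵥ (pinv N *ᵥ a)) = ridgeScore M lam a := by
    rw [← ha, dotProduct_comm]; rfl
  rw [hax, ← dotProduct_ridge_mulVec, ← hN]
  have := dotProduct_mulVec_sq_le hNh h0 x (pinv N *ᵥ a)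
  rw [hτ] at this
  nlinarith [h0 x]

/-- A row of large ridge leverage score has a witness. -/
theorem exists_witness_of_le_ridgeScore (M : Matrix m (Fin d) ℝ) (lam : ℝ) (a : Fin d → ℝ) :
    ∃ x, a ⬝ᵥ x = ridgeScore M lam a ∧
      (M *ᵥ x) ⬝ᵥ (M *ᵥ x) + lam * (x ⬝ᵥ x) = ridgeScore M lam a ∧
      (lam = 0 → x ∈ rowspace M) := by
  have hNh := isHermitian_ridge M lam
  have hP := isMoorePenrose_pinv hNh
  have hT := transpose_pinv hNh
  -- With `N` the ridge matrix, `x = N⁺a` is the equality case of Cauchy–Schwarz, and `N⁺NN⁺ = N⁺`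
  -- evaluates its form.
  refine ⟨pinv (Mᵀ * M + lam • (1 : Matrix (Fin d) (Fin d) ℝ)) *ᵥ a, rfl, ?_, fun h => ?_⟩
  · rw [← dotProduct_ridge_mulVec, mulVec_mulVec, dotProduct_comm, dotProduct_mulVec,
      ← mulVec_transpose, mulVec_mulVec, dotProduct_comm, hT, ← Matrix.mul_assoc,
      hP.mul_mul_right]
    rfl
  · subst h
    rw [← hP.mul_mul_right, ← hP.symm_right, transpose_mul, transpose_eq_of_isHermitian hNh,
      zero_smul, add_zero, Matrix.mul_assoc, Matrix.mul_assoc, ← mulVec_mulVec]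
    exact transpose_mulVec_mem_rowspace _ _

theorem exists_orthogonal_of_notMem_rowspace {M : Matrix m (Fin d) ℝ} {a : Fin d → ℝ}
    (ha : a ∉ rowspace M) : ∃ u, u ≠ 0 ∧ M *ᵥ u = 0 ∧ a - u ∈ rowspace M := by
  have hNh : (Mᵀ * M).IsHermitian := by simpa using isHermitian_ridge M 0
  have hmem : (Mᵀ * M) *ᵥ (pinv (Mᵀ * M) *ᵥ a) ∈ rowspace M := by
    rw [← mulVec_mulVec]
    exact transpose_mulVec_mem_rowspace _ _
  refine ⟨a - (Mᵀ * M) *ᵥ (pinv (Mᵀ * M) *ᵥ a), fun h => ha ?_, gram_mulVec_eq_zero ?_, ?_⟩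
  · rw [sub_eq_zero.1 h]; exact hmem
  · rw [mulVec_sub, mulVec_mulVec, mulVec_mulVec, mul_mul_pinv hNh, sub_self]
  · rw [sub_sub_cancel]; exact hmem

theorem frobSq_eq_sum (M : Matrix m (Fin d) ℝ) : frobSq M = ∑ i, M i ⬝ᵥ M i := by
  simp [frobSq, dotProduct, sq]

theorem frobSq_nonneg (M : Matrix m (Fin d) ℝ) : 0 ≤ frobSq M :=
  Finset.sum_nonneg fun _ _ => Finset.sum_nonneg fun _ _ => sq_nonneg _

theorem tailSq_le {k : ℕ} {M X : Matrix m (Fin d) ℝ} (hX : X.rank ≤ k) :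
    tailSq k M ≤ frobSq (M - X) :=
  csInf_le ⟨0, by rintro _ ⟨_, _, rfl⟩; exact frobSq_nonneg _⟩ ⟨X, hX, rfl⟩

theorem le_tailSq {k : ℕ} {M : Matrix m (Fin d) ℝ} {c : ℝ}
    (h : ∀ X : Matrix m (Fin d) ℝ, X.rank ≤ k → c ≤ frobSq (M - X)) : c ≤ tailSq k M :=
  le_csInf ⟨_, 0, by simp, rfl⟩ (by rintro _ ⟨X, hX, rfl⟩; exact h X hX)

theorem tailSq_nonneg (k : ℕ) (M : Matrix m (Fin d) ℝ) : 0 ≤ tailSq k M :=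
  le_tailSq fun _ _ => frobSq_nonneg _

theorem tailSq_eq_zero {k : ℕ} {M : Matrix m (Fin d) ℝ} (h : M.rank ≤ k) : tailSq k M = 0 :=
  le_antisymm ((tailSq_le h).trans (by simp [frobSq])) (tailSq_nonneg _ _)

theorem mulVec_dotProduct_self_le_frobSq (M : Matrix m (Fin d) ℝ) (x : Fin d → ℝ) :
    (M *ᵥ x) ⬝ᵥ (M *ᵥ x) ≤ frobSq M * (x ⬝ᵥ x) := by
  rw [frobSq, Finset.sum_mul]
  refine Finset.sum_le_sum fun i _ => ?_
  have := Finset.sum_mul_sq_le_sq_mul_sq Finset.univ (M i) x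
  simpa [mulVec, dotProduct, sq] using this

theorem frobSq_eq_trace (M : Matrix m (Fin d) ℝ) : frobSq M = (M * Mᵀ).trace := by
  simp [frobSq, Matrix.trace, mul_apply, sq]

theorem trace_eq_sum_eigenvectorBasis {H : Matrix (Fin d) (Fin d) ℝ} (hH : H.IsHermitian)
    (N : Matrix (Fin d) (Fin d) ℝ) :
    N.trace = ∑ i, (hH.eigenvectorBasis i).ofLp ⬝ᵥ (N *ᵥ (hH.eigenvectorBasis i).ofLp) := by
  have h := LinearMap.trace_eq_sum_inner (toEuclideanLin N) hH.eigenvectorBasis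
  have h2 : LinearMap.trace ℝ _ (toEuclideanLin N) = N.trace := by
    rw [toEuclideanLin_eq_toLin_orthonormal,
      LinearMap.trace_eq_matrix_trace ℝ (EuclideanSpace.basisFun (Fin d) ℝ).toBasis,
      LinearMap.toMatrix_toLin]
  rw [← h2, h]
  refine Finset.sum_congr rfl fun i _ => ?_
  rw [EuclideanSpace.inner_eq_star_dotProduct, dotProduct_comm]
  simp

end LinearAlgebra

/-! ### The log-determinant potential -/

section LogDet

variable {m : Type*} [Fintype m] {d : ℕ}

theorem trace_eq_rank_of_idempotent {P : Matrix (Fin d) (Fin d) ℝ} (hP : P * P = P) :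
    Matrix.trace P = P.rank := by
  have h : IsIdempotentElem (toLin' P) := by
    rw [IsIdempotentElem, Module.End.mul_eq_comp, ← toLin'_mul, hP]
  rw [← trace_toLin'_eq, (LinearMap.IsIdempotentElem.isProj_range _ h).trace]
  rfl

/-- The orthogonal projection onto the row space. -/
theorem exists_rowspace_projection (X : Matrix m (Fin d) ℝ) :
    ∃ P : Matrix (Fin d) (Fin d) ℝ, Pᵀ = P ∧ P * P = P ∧ X * P = X ∧
      Matrix.trace P ≤ X.rank := by
  have hN : (Xᵀ * X).IsHermitian := by simpa using isHermitian_ridge X 0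
  have hP := isMoorePenrose_pinv hN
  have hid : (pinv (Xᵀ * X) * (Xᵀ * X)) * (pinv (Xᵀ * X) * (Xᵀ * X)) =
      pinv (Xᵀ * X) * (Xᵀ * X) := by
    rw [← Matrix.mul_assoc, hP.mul_mul_right]
  refine ⟨pinv (Xᵀ * X) * (Xᵀ * X), hP.symm_right, hid, ?_, ?_⟩
  -- `P = N⁺N` with `N = XᵀX`, so `N(P - 1) = 0`; since `N` and `X` have the same kernel, `X(P - 1)
  -- = 0`.
  · rw [← sub_eq_zero]
    refine ext_of_mulVec_single fun j => ?_
    have h := gram_mulVec_eq_zero (M := X)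
      (v := (pinv (Xᵀ * X) * (Xᵀ * X) - 1) *ᵥ Pi.single j 1) (by
        rw [mulVec_mulVec, Matrix.mul_sub, ← Matrix.mul_assoc, hP.mul_mul_left, Matrix.mul_one,
          sub_self, zero_mulVec])
    rw [zero_mulVec, ← h, mulVec_mulVec, Matrix.mul_sub, Matrix.mul_one]
  · rw [trace_eq_rank_of_idempotent hid]
    have h := (rank_mul_le_right (pinv (Xᵀ * X)) (Xᵀ * X)).trans (rank_mul_le_right Xᵀ X)
    exact Nat.cast_le.2 h

theorem frobSq_mul_one_sub_le (Y : Matrix m (Fin d) ℝ) {P : Matrix (Fin d) (Fin d) ℝ}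
    (hT : Pᵀ = P) (hP : P * P = P) : frobSq (Y * (1 - P)) ≤ frobSq Y := by
  have h : frobSq (Y * (1 - P)) + frobSq (Y * P) = frobSq Y := by
    simp only [frobSq_eq_trace, transpose_mul, transpose_sub, transpose_one, hT]
    rw [← Matrix.trace_add]
    congr 1
    have e1 : Y * (1 - P) * ((1 - P) * Yᵀ) = Y * ((1 - P) * (1 - P)) * Yᵀ := by
      simp only [Matrix.mul_assoc]
    have e2 : Y * P * (P * Yᵀ) = Y * (P * P) * Yᵀ := by simp only [Matrix.mul_assoc]
    have e3 : (1 - P) * (1 - P) = 1 - P := by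
      rw [Matrix.mul_sub, Matrix.sub_mul, Matrix.sub_mul, hP]; simp
    rw [e1, e2, e3, hP, ← Matrix.add_mul, ← Matrix.mul_add]
    simp
  have := frobSq_nonneg (Y * P)
  linarith

theorem one_add_smul_gram_quad (B : Matrix m (Fin d) ℝ) (c : ℝ) (x y : Fin d → ℝ) :
    x ⬝ᵥ ((1 + c • (Bᵀ * B)) *ᵥ y) = x ⬝ᵥ y + c * ((B *ᵥ x) ⬝ᵥ (B *ᵥ y)) := by
  rw [add_mulVec, dotProduct_add, one_mulVec, smul_mulVec, dotProduct_smul,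
    dotProduct_gram_mulVec, smul_eq_mul]

theorem isHermitian_one_add_smul_gram (B : Matrix m (Fin d) ℝ) (c : ℝ) :
    (1 + c • (Bᵀ * B)).IsHermitian := by
  rw [IsHermitian, conjTranspose_eq_transpose_of_trivial]
  simp

theorem eigenvectorBasis_dotProduct_self {H : Matrix (Fin d) (Fin d) ℝ} (hH : H.IsHermitian)
    (i : Fin d) :
    (hH.eigenvectorBasis i).ofLp ⬝ᵥ (hH.eigenvectorBasis i).ofLp = 1 := by
  have h := real_inner_self_eq_norm_sq (hH.eigenvectorBasis i)
  rw [hH.eigenvectorBasis.orthonormal.1 i, EuclideanSpace.inner_eq_star_dotProduct] at h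
  simpa using h

theorem eigenvalues_one_add_smul_gram (B : Matrix m (Fin d) ℝ) (c : ℝ) (i : Fin d) :
    ∃ u : Fin d → ℝ, u ⬝ᵥ u = 1 ∧
      (isHermitian_one_add_smul_gram B c).eigenvalues i = 1 + c * ((B *ᵥ u) ⬝ᵥ (B *ᵥ u)) := by
  have hH := isHermitian_one_add_smul_gram B c
  refine ⟨(hH.eigenvectorBasis i).ofLp, eigenvectorBasis_dotProduct_self hH i, ?_⟩
  have h := one_add_smul_gram_quad B c (hH.eigenvectorBasis i).ofLp (hH.eigenvectorBasis i).ofLp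
  rw [hH.mulVec_eigenvectorBasis, dotProduct_smul, eigenvectorBasis_dotProduct_self,
    smul_eq_mul, mul_one] at h
  exact h

theorem one_le_det_one_add_smul_gram (B : Matrix m (Fin d) ℝ) {c : ℝ} (hc : 0 ≤ c) :
    1 ≤ (1 + c • (Bᵀ * B)).det := by
  rw [(isHermitian_one_add_smul_gram B c).det_eq_prod_eigenvalues]
  rw [← Finset.prod_const_one (s := (Finset.univ : Finset (Fin d)))]
  refine Finset.prod_le_prod (fun _ _ => zero_le_one) fun i _ => ?_
  obtain ⟨u, -, h⟩ := eigenvalues_one_add_smul_gram B c i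
  have := mul_nonneg hc (mulVec_dotProduct_self_nonneg B u)
  simp only [RCLike.ofReal_real_eq_id, id]
  linarith

/-- Against any competitor `X`, let `P` project onto its row space and give the `i`-th eigenvector
the weight `w i = ⟨u i, P u i⟩ ∈ [0, 1]`. The weights sum to at most `k`. Each `log η` is bounded by
`log(1 + cα)` on the fraction `w` and by `η - 1` on the rest, and the latter parts add up to a trace
bounded by `c‖B - X‖_F²`. -/
theorem log_det_one_add_smul_gram_le (B : Matrix m (Fin d) ℝ) (k : ℕ) {α c : ℝ} (hc : 0 < c)
    (hα : 0 ≤ α) (hB : ∀ x, (B *ᵥ x) ⬝ᵥ (B *ᵥ x) ≤ α * (x ⬝ᵥ x)) :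
    Real.log (1 + c • (Bᵀ * B)).det ≤ k * Real.log (1 + c * α) + c * tailSq k B := by
  suffices h : ∀ X : Matrix m (Fin d) ℝ, X.rank ≤ k →
      Real.log (1 + c • (Bᵀ * B)).det ≤ k * Real.log (1 + c * α) + c * frobSq (B - X) by
    have h2 : (Real.log (1 + c • (Bᵀ * B)).det - k * Real.log (1 + c * α)) / c ≤ tailSq k B :=
      le_tailSq fun X hX => by
        rw [div_le_iff₀ hc]
        linarith [h X hX]
    rw [div_le_iff₀ hc] at h2
    linarith
  intro X hX
  obtain ⟨P, hT, hP, hXP, htr⟩ := exists_rowspace_projection X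
  have hH := isHermitian_one_add_smul_gram B c
  have heig := eigenvalues_one_add_smul_gram B c
  set H := 1 + c • (Bᵀ * B) with hHdef
  set u : Fin d → Fin d → ℝ := fun i => (hH.eigenvectorBasis i).ofLp with hu
  set η := hH.eigenvalues with hη
  have hη1 : ∀ i, 1 ≤ η i ∧ η i ≤ 1 + c * α := fun i => by
    obtain ⟨v, hv, h⟩ := heig i
    have h1 := mul_nonneg hc.le (mulVec_dotProduct_self_nonneg B v)
    have h2 := mul_le_mul_of_nonneg_left (hB v) hc.le
    rw [hv, mul_one] at h2
    constructor <;> linarith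
  set w : Fin d → ℝ := fun i => u i ⬝ᵥ (P *ᵥ u i) with hw
  have hsq : ∀ {Q : Matrix (Fin d) (Fin d) ℝ}, Qᵀ = Q → Q * Q = Q → ∀ x : Fin d → ℝ,
      0 ≤ x ⬝ᵥ (Q *ᵥ x) := fun {Q} h1 h2 x => by
    have := dotProduct_gram_mulVec Q x x
    rw [h1, h2] at this
    rw [this]
    exact mulVec_dotProduct_self_nonneg Q x
  have hw0 : ∀ i, 0 ≤ w i := fun i => hsq hT hP _
  have hQ2 : (1 - P) * (1 - P) = 1 - P := by
    rw [Matrix.mul_sub, Matrix.sub_mul, Matrix.sub_mul, hP]; simp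
  have hQT : (1 - P)ᵀ = 1 - P := by rw [transpose_sub, transpose_one, hT]
  have hw1' : ∀ i, u i ⬝ᵥ ((1 - P) *ᵥ u i) = 1 - w i := fun i => by
    rw [sub_mulVec, dotProduct_sub, one_mulVec, eigenvectorBasis_dotProduct_self]
  have hw1 : ∀ i, 0 ≤ 1 - w i := fun i => by
    rw [← hw1']
    exact hsq hQT hQ2 _
  have hsum : ∑ i, w i ≤ k := by
    rw [← trace_eq_sum_eigenvectorBasis hH P]
    exact htr.trans (by exact_mod_cast hX)
  -- The sum is `tr((H - 1)(1 - P)) = c‖B(1 - P)‖_F²`, and `X(1 - P) = 0` allows `B` to be replaced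
  -- by `B - X`.
  have htrace : ∑ i, (η i - 1) * (1 - w i) ≤ c * frobSq (B - X) := by
    have h1 : ∑ i, (η i - 1) * (1 - w i) = Matrix.trace ((H - 1) * (1 - P)) := by
      rw [trace_mul_comm, trace_eq_sum_eigenvectorBasis hH]
      refine Finset.sum_congr rfl fun i _ => ?_
      have hmv : (H - 1) *ᵥ (hH.eigenvectorBasis i).ofLp = (η i - 1) • u i := by
        rw [sub_mulVec, hH.mulVec_eigenvectorBasis, one_mulVec, sub_smul, one_smul]
      rw [← mulVec_mulVec, hmv, mulVec_smul, dotProduct_smul, hw1', smul_eq_mul]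
    have h2 : Matrix.trace ((H - 1) * (1 - P)) = c * frobSq (B * (1 - P)) := by
      rw [frobSq_eq_trace, trace_mul_comm (B * (1 - P)), transpose_mul, hQT, hHdef,
        add_sub_cancel_left, smul_mul, Matrix.trace_smul, smul_eq_mul]
      congr 1
      rw [← hQ2, ← Matrix.mul_assoc, trace_mul_comm, hQ2]
      simp only [Matrix.mul_assoc]
    have h3 : B * (1 - P) = (B - X) * (1 - P) := by
      rw [Matrix.sub_mul B X, Matrix.mul_sub X, hXP, Matrix.mul_one, sub_self, sub_zero]
    rw [h1, h2, h3]
    exact mul_le_mul_of_nonneg_left (frobSq_mul_one_sub_le _ hT hP) hc.le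
  have hdet : H.det = ∏ i, η i := by
    simpa using hH.det_eq_prod_eigenvalues
  have hlog0 : 0 ≤ Real.log (1 + c * α) := Real.log_nonneg (by nlinarith)
  rw [hdet, Real.log_prod fun i _ => by linarith [(hη1 i).1]]
  calc ∑ i, Real.log (η i)
      ≤ ∑ i, (w i * Real.log (1 + c * α) + (η i - 1) * (1 - w i)) := by
        refine Finset.sum_le_sum fun i _ => ?_
        have h0 : 0 < η i := by linarith [(hη1 i).1]
        have h1 := mul_le_mul_of_nonneg_left (Real.log_le_log h0 (hη1 i).2) (hw0 i)
        have h2 := mul_le_mul_of_nonneg_left (Real.log_le_sub_one_of_pos h0) (hw1 i)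
        linarith
    _ ≤ _ := by
        rw [Finset.sum_add_distrib, ← Finset.sum_mul]
        exact add_le_add (mul_le_mul_of_nonneg_right hsum hlog0) htrace

/-- The matrix determinant lemma with `r = c aᵀH⁻¹a`, where `H = 1 + c BᵀB`; the inequality is
Cauchy–Schwarz in the form `H`. It turns a direction in which `a` is large into a lower bound on the
determinant's growth. -/
theorem det_one_add_smul_gram_add_vecMulVec (B : Matrix m (Fin d) ℝ) {c : ℝ} (hc : 0 < c)
    (a : Fin d → ℝ) :
    ∃ r, 0 ≤ r ∧ (1 + c • (Bᵀ * B + vecMulVec a a)).det = (1 + c • (Bᵀ * B)).det * (1 + r) ∧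
      ∀ x, (a ⬝ᵥ x) ^ 2 ≤ r * ((B *ᵥ x) ⬝ᵥ (B *ᵥ x) + c⁻¹ * (x ⬝ᵥ x)) := by
  have hH := isHermitian_one_add_smul_gram B c
  have hdet := one_le_det_one_add_smul_gram B hc.le
  have hquad := one_add_smul_gram_quad B c
  set H := 1 + c • (Bᵀ * B) with hHdef
  have hunit : IsUnit H.det := isUnit_iff_ne_zero.2 (by linarith)
  have h0 : ∀ x, 0 ≤ x ⬝ᵥ (H *ᵥ x) := fun x => by
    rw [hquad]
    exact add_nonneg (dotProduct_self_nonneg' x)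
      (mul_nonneg hc.le (mulVec_dotProduct_self_nonneg B x))
  have hy : H *ᵥ (H⁻¹ *ᵥ a) = a := by
    rw [mulVec_mulVec, mul_nonsing_inv _ hunit, one_mulVec]
  set y := H⁻¹ *ᵥ a with hydef
  refine ⟨c * (y ⬝ᵥ a), mul_nonneg hc.le ?_, ?_, fun x => ?_⟩
  · have := h0 y
    rwa [hy] at this
  · have e : 1 + c • (Bᵀ * B + vecMulVec a a) =
        H + replicateCol Unit (c • a) * replicateRow Unit a := by
      rw [hHdef, smul_add, ← add_assoc, ← vecMulVec_eq, smul_vecMulVec]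
    rw [e, det_add_replicateCol_mul_replicateRow hunit, det_unique (n := Unit), Matrix.add_apply, one_apply_eq,
      Matrix.mul_assoc, ← replicateCol_mulVec, replicateRow_mul_replicateCol_apply, mulVec_smul,
      dotProduct_smul, smul_eq_mul, dotProduct_comm a]
  · have hax : a ⬝ᵥ x = y ⬝ᵥ (H *ᵥ x) := by
      conv_lhs => rw [← hy]
      rw [dotProduct_mulVec, ← mulVec_transpose, transpose_eq_of_isHermitian hH]
    have h := dotProduct_mulVec_sq_le hH h0 x y
    rw [hy, hquad x] at h
    rw [hax]
    refine h.trans_eq ?_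
    field_simp
    ring

end LogDet

/-! ### Singular values of prefixes and the online condition number -/

section ConditionNumber

theorem norm_sq_eq_dotProduct {ι : Type*} [Fintype ι] (x : EuclideanSpace ℝ ι) :
    ‖x‖ ^ 2 = x.ofLp ⬝ᵥ x.ofLp := by
  rw [EuclideanSpace.norm_sq_eq]
  simp [dotProduct, sq]

variable {m : Type*} [Fintype m] {d : ℕ}

theorem sigmaMin_nonneg (M : Matrix m (Fin d) ℝ) : 0 ≤ sigmaMin M :=
  Real.sInf_nonneg (by rintro _ ⟨_, i, rfl⟩; exact LinearMap.singularValues_nonneg _ i)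

theorem sigmaMin_pos {M : Matrix m (Fin d) ℝ} (hM : M ≠ 0) : 0 < sigmaMin M := by
  set S := {s : ℝ | s ≠ 0 ∧ ∃ i : ℕ, s = (toEuclideanLin M).singularValues i} with hS
  have hfin : S.Finite := by
    refine ((toEuclideanLin M).singularValues.support.finite_toSet.image
      (toEuclideanLin M).singularValues).subset ?_
    rintro _ ⟨h, i, rfl⟩
    exact ⟨i, by simpa only [Finset.mem_coe, Finsupp.mem_support_iff] using h, rfl⟩
  have hne : S.Nonempty := by
    by_contra h
    refine hM (toEuclideanLin.map_eq_zero_iff.1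
      ((LinearMap.singularValues_eq_zero_iff _).1 (Finsupp.ext fun i => ?_)))
    by_contra hi
    exact h ⟨_, hi, i, rfl⟩
  obtain ⟨h, i, hi⟩ := hne.csInf_mem hfin
  exact lt_of_le_of_ne (sigmaMin_nonneg M) (Ne.symm h)

/-- Expand `x` in an eigenbasis of `MᵀM`: the row space is orthogonal to the kernel, so only
non-zero singular values contribute. -/
theorem sigmaMin_sq_mul_le {M : Matrix m (Fin d) ℝ} {x : Fin d → ℝ} (hx : x ∈ rowspace M) :
    sigmaMin M ^ 2 * (x ⬝ᵥ x) ≤ (M *ᵥ x) ⬝ᵥ (M *ᵥ x) := by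
  set T := toEuclideanLin M with hT
  have hsym := T.isSymmetric_adjoint_comp_self
  set b := hsym.eigenvectorBasis rfl with hb
  have hTb : ∀ i y, inner ℝ (T (b i)) (T y) = hsym.eigenvalues rfl i * inner ℝ (b i) y := by
    intro i y
    rw [← LinearMap.adjoint_inner_left]
    have := hsym.apply_eigenvectorBasis rfl i
    rw [LinearMap.comp_apply] at this
    rw [hb, this]
    simp [inner_smul_left]
  set v : EuclideanSpace ℝ (Fin d) := WithLp.toLp 2 x with hv
  have hTv : ‖T v‖ ^ 2 = ∑ i, hsym.eigenvalues rfl i * inner ℝ (b i) v ^ 2 := by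
    rw [← real_inner_self_eq_norm_sq]
    have hexp : T v = ∑ i, inner ℝ (b i) v • T (b i) := by
      conv_lhs => rw [← b.sum_repr' v]
      simp
    conv_lhs => rw [hexp]
    rw [sum_inner]
    refine Finset.sum_congr rfl fun i _ => ?_
    rw [← hexp, real_inner_smul_left, hTb]
    ring
  have hnv : ‖v‖ ^ 2 = ∑ i, inner ℝ (b i) v ^ 2 := by
    rw [← b.sum_sq_norm_inner_right v]
    simp
  have h1 : ‖v‖ ^ 2 = x ⬝ᵥ x := norm_sq_eq_dotProduct v
  have h2 : ‖T v‖ ^ 2 = (M *ᵥ x) ⬝ᵥ (M *ᵥ x) := norm_sq_eq_dotProduct (T v)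
  rw [← h1, ← h2, hTv, hnv, Finset.mul_sum]
  refine Finset.sum_le_sum fun i _ => ?_
  have hsq := T.sq_singularValues_fin rfl i
  by_cases h0 : T.singularValues i = 0
  · have hTbi : T (b i) = 0 := by
      have := hTb i (b i)
      rw [← hsq, h0] at this
      simpa using this
    have hker : M *ᵥ (b i).ofLp = 0 := congrArg WithLp.ofLp hTbi
    have := dotProduct_eq_zero_of_mem_rowspace hx hker
    have hin : inner ℝ (b i) v = 0 := by
      rw [EuclideanSpace.inner_eq_star_dotProduct]
      simpa using this
    rw [hin]; simp
  · refine mul_le_mul_of_nonneg_right ?_ (sq_nonneg _)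
    rw [← hsq]
    refine pow_le_pow_left₀ (sigmaMin_nonneg M) (csInf_le ⟨0, ?_⟩ ⟨h0, i, rfl⟩) 2
    rintro _ ⟨_, j, rfl⟩
    exact LinearMap.singularValues_nonneg _ j

variable {n : ℕ}

theorem firstRows_mulVec_dotProduct_self (A : Matrix (Fin n) (Fin d) ℝ) (i : ℕ) (x : Fin d → ℝ) :
    (firstRows A i *ᵥ x) ⬝ᵥ (firstRows A i *ᵥ x) =
      ∑ j ∈ Finset.univ.filter (fun j : Fin n => (j : ℕ) < i), (A j ⬝ᵥ x) ^ 2 := by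
  rw [Finset.sum_subtype (p := fun j : Fin n => (j : ℕ) < i) _ (by simp)]
  simp only [dotProduct, sq]
  rfl

theorem rank_firstRows_mono (A : Matrix (Fin n) (Fin d) ℝ) {i j : ℕ} (h : i ≤ j) :
    (firstRows A i).rank ≤ (firstRows A j).rank := by
  rw [rank_eq_finrank_span_row, rank_eq_finrank_span_row]
  refine Submodule.finrank_mono (Submodule.span_mono ?_)
  rintro _ ⟨⟨l, hl⟩, rfl⟩
  exact ⟨⟨l, hl.trans_le h⟩, rfl⟩

theorem rank_firstRows_le_of_le_lastIndex {k : ℕ} {A : Matrix (Fin n) (Fin d) ℝ} {i : ℕ}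
    (h : i ≤ lastIndex k A) : (firstRows A i).rank ≤ k := by
  classical
  refine (rank_firstRows_mono A h).trans ?_
  unfold lastIndex
  exact Nat.findGreatest_spec (P := fun i => (firstRows A i).rank ≤ k) (Nat.zero_le n)
    ((rank_le_card_height _).trans (by simp))

theorem lt_rank_firstRows_of_lastIndex_lt {k : ℕ} {A : Matrix (Fin n) (Fin d) ℝ} {i : ℕ}
    (h : lastIndex k A < i) (hi : i ≤ n) : k < (firstRows A i).rank := by
  classical
  exact not_le.1 (Nat.findGreatest_is_greatest (P := fun i => (firstRows A i).rank ≤ k) h hi)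

open scoped Matrix.Norms.L2Operator in
-- Reduces the condition number to two quadratic-form inequalities, the only facts about it used
-- later.
theorem exists_onlineCond_eq {k : ℕ} (hk : 1 ≤ k) {A : Matrix (Fin n) (Fin d) ℝ} (hA : A ≠ 0) :
    ∃ a σ : ℝ, 0 < σ ∧ σ ≤ a ∧ onlineCond k A = a / σ ∧
      (∀ x, (A *ᵥ x) ⬝ᵥ (A *ᵥ x) ≤ a ^ 2 * (x ⬝ᵥ x)) ∧
      ∀ i ≤ n, i ≤ lastIndex k A + 1 → ∀ x ∈ rowspace (firstRows A i),
        σ ^ 2 * (x ⬝ᵥ x) ≤ (firstRows A i *ᵥ x) ⬝ᵥ (firstRows A i *ᵥ x) := by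
  set S := {s : ℝ | ∃ i : ℕ, i ≤ n ∧ i ≤ lastIndex k A + 1 ∧ firstRows A i ≠ 0 ∧
    s = sigmaMin (firstRows A i)} with hS
  have hfin : S.Finite := by
    refine ((Set.finite_Iic n).image fun i => sigmaMin (firstRows A i)).subset ?_
    rintro _ ⟨i, hi, -, -, rfl⟩
    exact ⟨i, hi, rfl⟩
  have hle : ∀ i ≤ n, i ≤ lastIndex k A + 1 → ∀ x ∈ rowspace (firstRows A i),
        sInf S ^ 2 * (x ⬝ᵥ x) ≤ (firstRows A i *ᵥ x) ⬝ᵥ (firstRows A i *ᵥ x) := by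
    intro i hi hi' x hx
    by_cases h0 : firstRows A i = 0
    · have : x ⬝ᵥ x = 0 := dotProduct_eq_zero_of_mem_rowspace hx (by rw [h0, zero_mulVec])
      rw [this, mul_zero]
      exact mulVec_dotProduct_self_nonneg _ _
    · refine le_trans (mul_le_mul_of_nonneg_right ?_ (dotProduct_self_nonneg' x))
        (sigmaMin_sq_mul_le hx)
      exact pow_le_pow_left₀ (Real.sInf_nonneg (by
        rintro _ ⟨_, _, _, _, rfl⟩; exact sigmaMin_nonneg _))
        (csInf_le hfin.bddBelow ⟨i, hi, hi', h0, rfl⟩) 2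
  have hop : ∀ x, (A *ᵥ x) ⬝ᵥ (A *ᵥ x) ≤ ‖A‖ ^ 2 * (x ⬝ᵥ x) := fun x => by
    have h := l2_opNorm_mulVec A (WithLp.toLp 2 x)
    have h1 := norm_sq_eq_dotProduct (WithLp.toLp 2 x)
    have h2 := norm_sq_eq_dotProduct ((EuclideanSpace.equiv (Fin n) ℝ).symm (A *ᵥ x))
    have h3 := pow_le_pow_left₀ (norm_nonneg _) h 2
    rw [mul_pow, h1] at h3
    exact h2.symm.trans_le h3
  -- The prefix ending at the first non-zero row has rank at most `1 ≤ k`, so it takes part in the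
  -- minimum. This makes the minimum positive, and testing on that row gives `σ ≤ ‖A‖`.
  have hex : ∃ t : ℕ, ∃ h : t < n, A ⟨t, h⟩ ≠ 0 := by
    by_contra! h
    exact hA (funext fun i => h i i.2)
  classical
  obtain ⟨ht, hat⟩ := Nat.find_spec hex
  have hmin : ∀ s < Nat.find hex, ∀ h : s < n, A ⟨s, h⟩ = 0 := fun s hs h => by
    have := Nat.find_min hex hs
    push Not at this
    exact this h
  set t := Nat.find hex
  have hzero : (firstRows A t).rank = 0 := by
    have : firstRows A t = 0 := funext fun j => hmin _ j.2 j.1.2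
    rw [this, rank_zero]
  have htl : t + 1 ≤ lastIndex k A := by
    refine Nat.le_findGreatest (P := fun i => (firstRows A i).rank ≤ k) ht ?_
    exact (rank_firstRows_succ_le A t).trans (by omega)
  have hmem : A ⟨t, ht⟩ ∈ rowspace (firstRows A (t + 1)) :=
    Submodule.subset_span ⟨⟨⟨t, ht⟩, Nat.lt_succ_self t⟩, rfl⟩
  have hne : firstRows A (t + 1) ≠ 0 := fun h =>
    hat (congrFun h ⟨⟨t, ht⟩, Nat.lt_succ_self t⟩)
  have hpos : 0 < sInf S := by
    obtain ⟨i, -, -, h0, h⟩ := Set.Nonempty.csInf_mem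
      (⟨_, t + 1, ht, by omega, hne, rfl⟩ : S.Nonempty) hfin
    rw [h]
    exact sigmaMin_pos h0
  refine ⟨‖A‖, sInf S, hpos, ?_, rfl, hop, hle⟩
  have h1 := hle (t + 1) ht (by omega) _ hmem
  have h2 : (firstRows A (t + 1) *ᵥ A ⟨t, ht⟩) ⬝ᵥ (firstRows A (t + 1) *ᵥ A ⟨t, ht⟩) ≤
      (A *ᵥ A ⟨t, ht⟩) ⬝ᵥ (A *ᵥ A ⟨t, ht⟩) := by
    rw [firstRows_mulVec_dotProduct_self]
    have : (A *ᵥ A ⟨t, ht⟩) ⬝ᵥ (A *ᵥ A ⟨t, ht⟩) = ∑ j, (A j ⬝ᵥ A ⟨t, ht⟩) ^ 2 := by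
      simp only [dotProduct, sq]; rfl
    rw [this]
    exact Finset.sum_le_univ_sum_of_nonneg fun j => sq_nonneg (A j ⬝ᵥ A ⟨t, ht⟩)
  have h3 := h1.trans (h2.trans (hop _))
  have h4 : 0 < A ⟨t, ht⟩ ⬝ᵥ A ⟨t, ht⟩ :=
    lt_of_le_of_ne (dotProduct_self_nonneg' _) fun h => hat (dotProduct_self_eq_zero.1 h.symm)
  exact le_of_sq_le_sq (le_of_mul_le_mul_right h3 h4) (norm_nonneg A)

end ConditionNumber

/-! ### The selection process: covering and witnesses -/

section Selection

variable {n d : ℕ}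

/-- The rows of `A` with index in `S`. -/
def rowsOn (A : Matrix (Fin n) (Fin d) ℝ) (S : Finset (Fin n)) : Matrix S (Fin d) ℝ :=
  A.submatrix Subtype.val id

theorem rowsOn_mulVec_dotProduct_self (A : Matrix (Fin n) (Fin d) ℝ) (S : Finset (Fin n))
    (x : Fin d → ℝ) :
    (rowsOn A S *ᵥ x) ⬝ᵥ (rowsOn A S *ᵥ x) = ∑ i ∈ S, (A i ⬝ᵥ x) ^ 2 := by
  rw [← Finset.sum_coe_sort]
  simp only [dotProduct, sq]
  rfl

theorem rowsOn_gram (A : Matrix (Fin n) (Fin d) ℝ) (S : Finset (Fin n)) :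
    (rowsOn A S)ᵀ * rowsOn A S = ∑ i ∈ S, vecMulVec (A i) (A i) := by
  ext x y
  rw [← Finset.sum_coe_sort, Matrix.sum_apply]
  simp only [mul_apply, vecMulVec_apply]
  rfl

/-- The selection rule for a row `a`, given the rows `M` selected so far. -/
def Accepts {m : Type*} [Fintype m] (k : ℕ) (M : Matrix m (Fin d) ℝ) (a : Fin d → ℝ) : Prop :=
  (tailSq k M / k = 0 ∧ a ∉ rowspace M) ∨
    1 / (1 + 1 / (k : ℝ)) ≤ ridgeScore M (tailSq k M / k) a

open Classical in
/-- The labels selected among the first `t` rows. -/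
noncomputable def kept (k : ℕ) (A : Matrix (Fin n) (Fin d) ℝ) : ℕ → Finset (Fin n)
  | 0 => ∅
  | t + 1 =>
    if h : t < n then
      if Accepts k (rowsOn A (kept k A t)) (A ⟨t, h⟩) then insert ⟨t, h⟩ (kept k A t)
      else kept k A t
    else kept k A t

/-- The ridge parameter after `t` rows. -/
noncomputable def ridgeAt (k : ℕ) (A : Matrix (Fin n) (Fin d) ℝ) (t : ℕ) : ℝ :=
  tailSq k (rowsOn A (kept k A t)) / k

variable {k : ℕ} {A : Matrix (Fin n) (Fin d) ℝ}

theorem kept_succ_of_accepts (i : Fin n) (h : Accepts k (rowsOn A (kept k A i)) (A i)) :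
    kept k A (i + 1) = insert i (kept k A i) := by
  rw [kept, dif_pos i.2, if_pos h]

theorem kept_succ_of_not_accepts (i : Fin n) (h : ¬ Accepts k (rowsOn A (kept k A i)) (A i)) :
    kept k A (i + 1) = kept k A i := by
  rw [kept, dif_pos i.2, if_neg h]

theorem kept_mono : Monotone (kept k A) := by
  refine monotone_nat_of_le_succ fun t => ?_
  rw [kept]
  split_ifs
  · exact Finset.subset_insert _ _
  · exact le_rfl
  · exact le_rfl

theorem lt_of_mem_kept {t : ℕ} {i : Fin n} (h : i ∈ kept k A t) : (i : ℕ) < t := by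
  induction t with
  | zero => simp [kept] at h
  | succ t ih =>
    rw [kept] at h
    split_ifs at h with h1 h2
    · rcases Finset.mem_insert.1 h with rfl | h
      · exact Nat.lt_succ_self t
      · exact (ih h).trans (Nat.lt_succ_self t)
    · exact (ih h).trans (Nat.lt_succ_self t)
    · exact (ih h).trans (Nat.lt_succ_self t)

theorem mem_kept_succ_iff (i : Fin n) :
    i ∈ kept k A (i + 1) ↔ Accepts k (rowsOn A (kept k A i)) (A i) := by
  by_cases h : Accepts k (rowsOn A (kept k A i)) (A i)
  · simp [kept_succ_of_accepts i h, h]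
  · rw [kept_succ_of_not_accepts i h]
    exact ⟨fun h' => absurd (lt_of_mem_kept h') (lt_irrefl _), fun h' => absurd h' h⟩

/-- A row can enter only at its own arrival. -/
theorem mem_kept_succ_of_mem {t : ℕ} {i : Fin n} (h : i ∈ kept k A t) :
    i ∈ kept k A (i + 1) := by
  induction t with
  | zero => simp [kept] at h
  | succ t ih =>
    by_cases hi : (i : ℕ) = t
    · rwa [hi]
    · have hlt := lt_of_mem_kept h
      refine ih ?_
      rw [kept] at h
      split_ifs at h with h1 h2
      · rcases Finset.mem_insert.1 h with rfl | h
        · exact absurd rfl hi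
        · exact h
      · exact h
      · exact h

theorem quad_kept_mono {s t : ℕ} (h : s ≤ t) (x : Fin d → ℝ) :
    (rowsOn A (kept k A s) *ᵥ x) ⬝ᵥ (rowsOn A (kept k A s) *ᵥ x) ≤
      (rowsOn A (kept k A t) *ᵥ x) ⬝ᵥ (rowsOn A (kept k A t) *ᵥ x) := by
  rw [rowsOn_mulVec_dotProduct_self, rowsOn_mulVec_dotProduct_self]
  exact Finset.sum_le_sum_of_subset_of_nonneg (kept_mono h) fun _ _ _ => sq_nonneg _

theorem ridgeAt_nonneg (k : ℕ) (A : Matrix (Fin n) (Fin d) ℝ) (t : ℕ) : 0 ≤ ridgeAt k A t :=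
  div_nonneg (tailSq_nonneg _ _) (Nat.cast_nonneg k)

/-- Every row is dominated by the rows selected up to its arrival, with regularisation. -/
theorem sq_dotProduct_le_kept (i : Fin n) (x : Fin d → ℝ) :
    (A i ⬝ᵥ x) ^ 2 ≤
      (rowsOn A (kept k A (i + 1)) *ᵥ x) ⬝ᵥ (rowsOn A (kept k A (i + 1)) *ᵥ x) +
        ridgeAt k A i * (x ⬝ᵥ x) := by
  by_cases h : Accepts k (rowsOn A (kept k A i)) (A i)
  · rw [rowsOn_mulVec_dotProduct_self]
    refine le_add_of_le_of_nonneg ?_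
      (mul_nonneg (ridgeAt_nonneg k A i) (dotProduct_self_nonneg' x))
    exact Finset.single_le_sum (f := fun j => (A j ⬝ᵥ x) ^ 2) (fun _ _ => sq_nonneg _)
      ((mem_kept_succ_iff i).2 h)
  · rw [kept_succ_of_not_accepts i h]
    rw [Accepts, not_or] at h
    refine sq_dotProduct_le_of_ridgeScore_le ?_ ?_ x
    · rcases (ridgeAt_nonneg k A i).lt_or_eq with h0 | h0
      · exact Or.inl h0
      · exact Or.inr ⟨h0.symm, by_contra fun h' => h.1 ⟨h0.symm, h'⟩⟩
    · refine (not_le.1 h.2).le.trans ?_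
      rw [div_le_one (by positivity)]
      exact le_add_of_nonneg_right (by positivity)

theorem rowspace_kept_le (t : ℕ) : rowspace (rowsOn A (kept k A t)) ≤ rowspace (firstRows A t) := by
  refine Submodule.span_mono ?_
  rintro _ ⟨⟨i, hi⟩, rfl⟩
  exact ⟨⟨i, lt_of_mem_kept hi⟩, rfl⟩

theorem ridgeAt_eq_zero {t : ℕ} (h : t ≤ lastIndex k A) : ridgeAt k A t = 0 := by
  rw [ridgeAt, tailSq_eq_zero, zero_div]
  refine le_trans ?_ (rank_firstRows_le_of_le_lastIndex h)
  rw [rank_eq_finrank_span_row, rank_eq_finrank_span_row]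
  exact Submodule.finrank_mono (rowspace_kept_le t)

/-- All rows of such a prefix arrive while the ridge parameter is zero, so covering holds without
regularisation; sum it over at most `n` rows. -/
theorem firstRows_quad_le_kept {t : ℕ} (h : t ≤ lastIndex k A + 1) (x : Fin d → ℝ) :
    (firstRows A t *ᵥ x) ⬝ᵥ (firstRows A t *ᵥ x) ≤
      n * ((rowsOn A (kept k A t) *ᵥ x) ⬝ᵥ (rowsOn A (kept k A t) *ᵥ x)) := by
  rw [firstRows_mulVec_dotProduct_self]
  have h0 := mulVec_dotProduct_self_nonneg (rowsOn A (kept k A t)) x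
  refine (Finset.sum_le_card_nsmul _ _
    ((rowsOn A (kept k A t) *ᵥ x) ⬝ᵥ (rowsOn A (kept k A t) *ᵥ x)) fun i hi => ?_).trans ?_
  · have hi : (i : ℕ) < t := (Finset.mem_filter.1 hi).2
    have := sq_dotProduct_le_kept (k := k) (A := A) i x
    rw [ridgeAt_eq_zero (by omega), zero_mul, add_zero] at this
    exact this.trans (quad_kept_mono hi x)
  · rw [nsmul_eq_mul]
    refine mul_le_mul_of_nonneg_right ?_ h0
    exact_mod_cast (Finset.card_le_univ _).trans_eq (Fintype.card_fin n)

theorem exists_mem_mulVec_eq_zero {m : Type*} [Fintype m] (X : Matrix m (Fin d) ℝ)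
    (W : Submodule ℝ (Fin d → ℝ)) (h : X.rank < Module.finrank ℝ W) :
    ∃ u ∈ W, u ≠ 0 ∧ X *ᵥ u = 0 := by
  have := LinearMap.ker_ne_bot_of_finrank_lt (f := X.mulVecLin.rangeRestrict ∘ₗ W.subtype) h
  obtain ⟨u, hu, hu0⟩ := Submodule.exists_mem_ne_zero_of_ne_bot this
  refine ⟨u, u.2, fun h => hu0 (Subtype.ext h), ?_⟩
  exact congrArg Subtype.val (LinearMap.mem_ker.1 hu)

/-- `σ` bounds the non-zero singular values of the relevant prefixes of `A` from below. -/
def PrefixBound (k : ℕ) (A : Matrix (Fin n) (Fin d) ℝ) (σ : ℝ) : Prop :=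
  ∀ i ≤ n, i ≤ lastIndex k A + 1 → ∀ x ∈ rowspace (firstRows A i),
    σ ^ 2 * (x ⬝ᵥ x) ≤ (firstRows A i *ᵥ x) ⬝ᵥ (firstRows A i *ᵥ x)

/-- The prefix of length `lastIndex k A + 1` has rank above `k`, so its row space contains a
non-zero `u` killed by any competitor `X` of rank at most `k`. Then `σ²‖u‖² ≤ n‖A_S u‖² = n‖(A_S -
X)u‖²`, which bounds the tail by `σ²/n` from below; dividing by `k ≤ n` gives the claim. -/
theorem le_ridgeAt {σ : ℝ} (hk : 1 ≤ k) (hσ : PrefixBound k A σ) {t : ℕ}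
    (ht : lastIndex k A < t) (htn : t ≤ n) : σ ^ 2 / n ^ 2 ≤ ridgeAt k A t := by
  have hrk := lt_rank_firstRows_of_lastIndex_lt (Nat.lt_succ_self (lastIndex k A))
    (Nat.succ_le_of_lt (ht.trans_le htn))
  have hkn : k ≤ n := (hrk.le.trans (rank_le_card_height _)).trans
    ((Fintype.card_subtype_le _).trans_eq (Fintype.card_fin n))
  have hk0 : (0 : ℝ) < k := by exact_mod_cast hk
  have hkn' : (k : ℝ) ≤ n := by exact_mod_cast hkn
  have hn0 : (0 : ℝ) < n := hk0.trans_le hkn'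
  have htail : σ ^ 2 / n ≤ tailSq k (rowsOn A (kept k A t)) := by
    refine le_tailSq fun X hX => ?_
    rw [rank_eq_finrank_span_row] at hrk
    obtain ⟨u, hu, hu0, hXu⟩ := exists_mem_mulVec_eq_zero X _ (hX.trans_lt hrk)
    have hpos : 0 < u ⬝ᵥ u :=
      lt_of_le_of_ne (dotProduct_self_nonneg' _) fun h => hu0 (dotProduct_self_eq_zero.1 h.symm)
    have h1 := hσ _ (Nat.succ_le_of_lt (ht.trans_le htn)) le_rfl u hu
    have h2 := firstRows_quad_le_kept (le_refl (lastIndex k A + 1)) u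
    have h3 := quad_kept_mono (k := k) (A := A) (Nat.succ_le_of_lt ht) u
    have h4 := mulVec_dotProduct_self_le_frobSq (rowsOn A (kept k A t) - X) u
    rw [sub_mulVec, hXu, sub_zero] at h4
    rw [div_le_iff₀ hn0]
    refine le_of_mul_le_mul_right ?_ hpos
    calc σ ^ 2 * (u ⬝ᵥ u) ≤ _ := h1
      _ ≤ _ := h2
      _ ≤ n * (frobSq (rowsOn A (kept k A t) - X) * (u ⬝ᵥ u)) :=
        mul_le_mul_of_nonneg_left (h3.trans h4) hn0.le
      _ = _ := by ring
  rw [ridgeAt, le_div_iff₀ hk0]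
  refine le_trans ?_ htail
  rw [div_mul_eq_mul_div, div_le_div_iff₀ (by positivity) hn0]
  have : σ ^ 2 * k * n ≤ σ ^ 2 * n * n := by gcongr
  linarith

theorem half_le_threshold (hk : 1 ≤ k) : (1 : ℝ) / 2 ≤ 1 / (1 + 1 / (k : ℝ)) := by
  have hk0 : (1 : ℝ) ≤ k := by exact_mod_cast hk
  have : 1 / (k : ℝ) ≤ 1 := by rw [div_le_one (by linarith)]; exact hk0
  exact one_div_le_one_div_of_le (by positivity) (by linarith)

/-- Every selected row is large in some direction. -/
theorem exists_witness_of_accepts {σ : ℝ} (hk : 1 ≤ k) (hσ0 : 0 < σ) (hσ : PrefixBound k A σ)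
    (i : Fin n) (h : Accepts k (rowsOn A (kept k A i)) (A i)) :
    ∃ x, A i ⬝ᵥ x ≠ 0 ∧
      (rowsOn A (kept k A i) *ᵥ x) ⬝ᵥ (rowsOn A (kept k A i) *ᵥ x) +
        max (ridgeAt k A i) (σ ^ 2 / n ^ 2) * (x ⬝ᵥ x) ≤ 4 * (A i ⬝ᵥ x) ^ 2 := by
  have hn1 : (1 : ℝ) ≤ n := by exact_mod_cast Nat.one_le_of_lt i.2
  have hΛ0 : 0 < σ ^ 2 / (n : ℝ) ^ 2 := by positivity
  have hscore : 1 / (1 + 1 / (k : ℝ)) ≤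
      ridgeScore (rowsOn A (kept k A i)) (ridgeAt k A i) (A i) →
      (1 : ℝ) / 2 ≤ ridgeScore (rowsOn A (kept k A i)) (ridgeAt k A i) (A i) :=
    fun h => (half_le_threshold hk).trans h
  obtain ⟨x, hax, hx, hxr⟩ :=
    exists_witness_of_le_ridgeScore (rowsOn A (kept k A i)) (ridgeAt k A i) (A i)
  rcases le_or_gt (i : ℕ) (lastIndex k A) with hi | hi
  · have hr0 : ridgeAt k A i = 0 := ridgeAt_eq_zero hi
    rw [hr0, max_eq_right hΛ0.le]
    rw [hr0] at hx hax hxr hscore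
    by_cases hmem : A i ∈ rowspace (rowsOn A (kept k A i))
    · have hs := hscore (h.elim (fun h => absurd hmem h.2) fun h => by
        rw [← hr0]; exact h)
      -- Zero ridge, row in the span: `x` lies in the row space of a prefix, so `(σ²/n²)‖x‖²` is at
      -- most the score `τ`, and `2τ ≤ 4τ²` because `τ ≥ 1/2`.
      refine ⟨x, by rw [hax]; linarith, ?_⟩
      have h1 := hσ i i.2.le (by omega) x (rowspace_kept_le _ (hxr rfl))
      have h2 := firstRows_quad_le_kept (hi.trans (Nat.le_succ _)) x
      rw [hax]
      rw [zero_mul, add_zero] at hx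
      rw [hx] at h2 ⊢
      have h3 : σ ^ 2 / (n : ℝ) ^ 2 * (x ⬝ᵥ x) ≤
          ridgeScore (rowsOn A (kept k A i)) 0 (A i) := by
        rw [div_mul_eq_mul_div, div_le_iff₀ (by positivity)]
        refine (h1.trans h2).trans ?_
        rw [mul_comm]
        exact mul_le_mul_of_nonneg_left (by nlinarith) (by linarith)
      nlinarith
    -- Zero ridge, new direction: by covering, `u` is orthogonal to all earlier rows, selected or
    -- not, so row `i` alone carries the form of the prefix of length `i + 1`. That length may be
    -- `lastIndex k A + 1`, one past the last prefix of rank at most `k`.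
    · obtain ⟨u, hu0, hMu, hau⟩ := exists_orthogonal_of_notMem_rowspace hmem
      have hpos : 0 < u ⬝ᵥ u :=
        lt_of_le_of_ne (dotProduct_self_nonneg' _) fun h => hu0 (dotProduct_self_eq_zero.1 h.symm)
      have hu : u ∈ rowspace (firstRows A (i + 1)) := by
        have h1 : A i ∈ rowspace (firstRows A (i + 1)) :=
          Submodule.subset_span ⟨⟨i, Nat.lt_succ_self _⟩, rfl⟩
        have h2 : A i - u ∈ rowspace (firstRows A (i + 1)) := by
          refine (Submodule.span_mono ?_ : rowspace (firstRows A i) ≤ _) (rowspace_kept_le _ hau)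
          rintro _ ⟨⟨j, hj⟩, rfl⟩
          exact ⟨⟨j, hj.trans (Nat.lt_succ_self _)⟩, rfl⟩
        simpa using Submodule.sub_mem _ h1 h2
      have h1 := hσ (i + 1) i.2 (by omega) u hu
      have h2 : (firstRows A (i + 1) *ᵥ u) ⬝ᵥ (firstRows A (i + 1) *ᵥ u) = (A i ⬝ᵥ u) ^ 2 := by
        rw [firstRows_mulVec_dotProduct_self]
        refine Finset.sum_eq_single i (fun j hj hji => ?_) (fun h => absurd ?_ h)
        · have hj : (j : ℕ) < i := lt_of_le_of_ne
            (Nat.lt_succ_iff.1 (Finset.mem_filter.1 hj).2) fun h => hji (Fin.ext h)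
          have h3 := sq_dotProduct_le_kept (k := k) (A := A) j u
          rw [ridgeAt_eq_zero (by omega), zero_mul, add_zero] at h3
          have h4 := h3.trans (quad_kept_mono hj u)
          rw [hMu, dotProduct_zero] at h4
          exact le_antisymm h4 (sq_nonneg _)
        · exact Finset.mem_filter.2 ⟨Finset.mem_univ _, Nat.lt_succ_self _⟩
      rw [h2] at h1
      have h3 : 0 < σ ^ 2 * (u ⬝ᵥ u) := by positivity
      have h4 : σ ^ 2 / (n : ℝ) ^ 2 ≤ σ ^ 2 := div_le_self (by positivity) (one_le_pow₀ hn1)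
      refine ⟨u, fun h => ?_, ?_⟩
      · rw [h] at h1; norm_num at h1; linarith
      · rw [hMu, dotProduct_zero, zero_add]
        nlinarith [mul_le_mul_of_nonneg_right h4 hpos.le]
  -- Here the ridge parameter already exceeds the floor, so only the score test can have accepted
  -- the row.
  · have hge := le_ridgeAt hk hσ hi i.2.le
    have hs := hscore (h.resolve_left fun h => by
      have h0 : ridgeAt k A i = 0 := h.1
      linarith)
    refine ⟨x, by rw [hax]; linarith, ?_⟩
    rw [max_eq_left hge, hx, hax]
    nlinarith

theorem dotProduct_self_row_le {a : ℝ} (hA : ∀ x, (A *ᵥ x) ⬝ᵥ (A *ᵥ x) ≤ a ^ 2 * (x ⬝ᵥ x))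
    (i : Fin n) : A i ⬝ᵥ A i ≤ a ^ 2 := by
  have h1 : (A i ⬝ᵥ A i) ^ 2 ≤ (A *ᵥ A i) ⬝ᵥ (A *ᵥ A i) := by
    have e : (A *ᵥ A i) ⬝ᵥ (A *ᵥ A i) = ∑ j, (A j ⬝ᵥ A i) ^ 2 := by
      simp only [dotProduct, sq]; rfl
    rw [e]
    exact Finset.single_le_sum (f := fun j => (A j ⬝ᵥ A i) ^ 2) (fun _ _ => sq_nonneg _)
      (Finset.mem_univ i)
  have h2 := h1.trans (hA (A i))
  rcases (dotProduct_self_nonneg' (A i)).lt_or_eq with h | h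
  · rw [sq] at h2
    exact le_of_mul_le_mul_right h2 h
  · rw [← h]; positivity

theorem ridgeAt_le {a : ℝ} (hk : 1 ≤ k)
    (hA : ∀ x, (A *ᵥ x) ⬝ᵥ (A *ᵥ x) ≤ a ^ 2 * (x ⬝ᵥ x)) (t : ℕ) :
    ridgeAt k A t ≤ n * a ^ 2 := by
  refine (div_le_self (tailSq_nonneg _ _) (by exact_mod_cast hk)).trans ?_
  refine (tailSq_le (X := 0) (by simp)).trans ?_
  rw [sub_zero, frobSq_eq_sum]
  refine (Finset.sum_le_card_nsmul Finset.univ _ (a ^ 2) fun i _ =>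
    (dotProduct_self_row_le hA i.1 : rowsOn A (kept k A t) i ⬝ᵥ rowsOn A (kept k A t) i ≤ _)).trans ?_
  rw [nsmul_eq_mul]
  refine mul_le_mul_of_nonneg_right ?_ (sq_nonneg a)
  simpa using (Finset.card_le_univ (kept k A t))

theorem quad_kept_le {a : ℝ} (hA : ∀ x, (A *ᵥ x) ⬝ᵥ (A *ᵥ x) ≤ a ^ 2 * (x ⬝ᵥ x)) (t : ℕ)
    (x : Fin d → ℝ) :
    (rowsOn A (kept k A t) *ᵥ x) ⬝ᵥ (rowsOn A (kept k A t) *ᵥ x) ≤ a ^ 2 * (x ⬝ᵥ x) := by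
  refine le_trans ?_ (hA x)
  rw [rowsOn_mulVec_dotProduct_self]
  have e : (A *ᵥ x) ⬝ᵥ (A *ᵥ x) = ∑ j, (A j ⬝ᵥ x) ^ 2 := by
    simp only [dotProduct, sq]; rfl
  rw [e]
  exact Finset.sum_le_univ_sum_of_nonneg fun j => sq_nonneg (A j ⬝ᵥ x)

end Selection

/-! ### Counting the selected rows -/

section Counting

variable {n d k : ℕ} {A : Matrix (Fin n) (Fin d) ℝ} {a σ : ℝ}

/-- The ridge parameter after `t` rows, truncated from below. -/
noncomputable def floorRidge (k : ℕ) (A : Matrix (Fin n) (Fin d) ℝ) (σ : ℝ) (t : ℕ) : ℝ :=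
  max (ridgeAt k A t) (σ ^ 2 / n ^ 2)

/-- The log-determinant potential after `t` rows. -/
noncomputable def potential (k : ℕ) (A : Matrix (Fin n) (Fin d) ℝ) (c : ℝ) (t : ℕ) : ℝ :=
  Real.log (1 + c • ((rowsOn A (kept k A t))ᵀ * rowsOn A (kept k A t))).det

theorem potential_succ_of_accepts {c : ℝ} (hc : 0 < c) (i : Fin n)
    (h : Accepts k (rowsOn A (kept k A i)) (A i)) :
    ∃ r, 0 ≤ r ∧ potential k A c (i + 1) = potential k A c i + Real.log (1 + r) ∧
      ∀ x, (A i ⬝ᵥ x) ^ 2 ≤ r * ((rowsOn A (kept k A i) *ᵥ x) ⬝ᵥ (rowsOn A (kept k A i) *ᵥ x) +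
        c⁻¹ * (x ⬝ᵥ x)) := by
  obtain ⟨r, hr, hdet, hx⟩ := det_one_add_smul_gram_add_vecMulVec (rowsOn A (kept k A i)) hc (A i)
  refine ⟨r, hr, ?_, hx⟩
  have hg : (rowsOn A (kept k A (i + 1)))ᵀ * rowsOn A (kept k A (i + 1)) =
      (rowsOn A (kept k A i))ᵀ * rowsOn A (kept k A i) + vecMulVec (A i) (A i) := by
    rw [kept_succ_of_accepts i h, rowsOn_gram, rowsOn_gram,
      Finset.sum_insert fun h => lt_irrefl _ (lt_of_mem_kept h), add_comm]
  have h1 := one_le_det_one_add_smul_gram (rowsOn A (kept k A i)) hc.le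
  rw [potential, potential, hg, hdet, Real.log_mul (by linarith) (by linarith)]

/-- Every selection keeps the potential from decreasing; for one counted here the witness forces `r
≥ 1/4`, a gain of at least `log(5/4)`. -/
theorem card_filter_kept_mul_le (hk : 1 ≤ k) (hσ0 : 0 < σ) (hσ : PrefixBound k A σ) {Λ : ℝ}
    (hΛ : 0 < Λ) (t : ℕ) :
    (((kept k A t).filter fun i : Fin n => Λ ≤ floorRidge k A σ i).card : ℝ) * Real.log (5 / 4) ≤
      potential k A Λ⁻¹ t := by
  have hc : 0 < Λ⁻¹ := inv_pos.2 hΛ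
  induction t with
  | zero =>
    simp only [kept, Finset.filter_empty, Finset.card_empty, Nat.cast_zero, zero_mul]
    exact Real.log_nonneg (one_le_det_one_add_smul_gram _ hc.le)
  | succ t ih =>
    by_cases h : ∃ h : t < n, Accepts k (rowsOn A (kept k A t)) (A ⟨t, h⟩)
    · obtain ⟨htn, h⟩ := h
      obtain ⟨r, hr, hpot, hx⟩ := potential_succ_of_accepts hc ⟨t, htn⟩ h
      rw [hpot, kept_succ_of_accepts ⟨t, htn⟩ h, Finset.filter_insert]
      split_ifs with hmu
      · rw [Finset.card_insert_of_notMem fun h =>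
          lt_irrefl _ (lt_of_mem_kept (Finset.mem_filter.1 h).1)]
        obtain ⟨x, hx0, hxw⟩ := exists_witness_of_accepts hk hσ0 hσ ⟨t, htn⟩ h
        have hr4 : 1 / 4 ≤ r := by
          have h1 := hx x
          rw [inv_inv] at h1
          have h2 := mul_le_mul_of_nonneg_right hmu (dotProduct_self_nonneg' x)
          rw [floorRidge] at h2
          have h3 : (A ⟨t, htn⟩ ⬝ᵥ x) ^ 2 ≤ r * (4 * (A ⟨t, htn⟩ ⬝ᵥ x) ^ 2) :=
            h1.trans (mul_le_mul_of_nonneg_left (by linarith) hr)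
          have h4 : 0 < (A ⟨t, htn⟩ ⬝ᵥ x) ^ 2 := by positivity
          nlinarith
        have hlog : Real.log (5 / 4) ≤ Real.log (1 + r) :=
          Real.log_le_log (by norm_num) (by linarith)
        push_cast
        linarith
      · have : 0 ≤ Real.log (1 + r) := Real.log_nonneg (by linarith)
        exact le_add_of_le_of_nonneg ih this
    · have hkept : kept k A (t + 1) = kept k A t := by
        rw [kept]
        split_ifs with h1 h2
        · exact absurd ⟨h1, h2⟩ h
        · rfl
        · rfl
      rw [potential, hkept]
      exact ih

/-- The ridge parameter need not be monotone, so the epoch may be scattered in time. Compare both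
bounds on the potential just before its last member `j`: the tail at that time is at most `2Λk`, and
every other member is already counted. The `- 1` accounts for `j`. -/
theorem card_epoch_mul_le (hk : 1 ≤ k) (hσ0 : 0 < σ) (hσ : PrefixBound k A σ)
    (hA : ∀ x, (A *ᵥ x) ⬝ᵥ (A *ᵥ x) ≤ a ^ 2 * (x ⬝ᵥ x)) {Λ : ℝ} (hΛ : 0 < Λ) :
    ((((kept k A n).filter fun i : Fin n => Λ ≤ floorRidge k A σ i ∧
      floorRidge k A σ i < 2 * Λ).card : ℝ) - 1) * Real.log (5 / 4) ≤
      k * Real.log (1 + Λ⁻¹ * a ^ 2) + 2 * k := by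
  set E := (kept k A n).filter fun i : Fin n => Λ ≤ floorRidge k A σ i ∧ floorRidge k A σ i < 2 * Λ with hE
  have hlog : 0 ≤ Real.log (5 / 4) := Real.log_nonneg (by norm_num)
  have hc : 0 < Λ⁻¹ := inv_pos.2 hΛ
  have hlog' : 0 ≤ Real.log (1 + Λ⁻¹ * a ^ 2) :=
    Real.log_nonneg (le_add_of_nonneg_right (by positivity))
  have hk0 : (0 : ℝ) < k := by exact_mod_cast hk
  rcases E.eq_empty_or_nonempty with h | h
  · rw [h, Finset.card_empty]
    have : 0 ≤ k * Real.log (1 + Λ⁻¹ * a ^ 2) := by positivity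
    push_cast
    linarith
  · set j := E.max' h with hj
    have hjE := E.max'_mem h
    have hsub : E ⊆ insert j ((kept k A j).filter fun i : Fin n => Λ ≤ floorRidge k A σ i) := by
      intro i hi
      rcases (E.le_max' i hi).lt_or_eq with hlt | heq
      · refine Finset.mem_insert_of_mem (Finset.mem_filter.2 ⟨?_, (Finset.mem_filter.1 hi).2.1⟩)
        exact kept_mono (show (i : ℕ) + 1 ≤ j from hlt) (mem_kept_succ_of_mem (Finset.mem_filter.1 hi).1)
      · rw [heq]; exact Finset.mem_insert_self _ _
    have hcard : (E.card : ℝ) ≤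
        ((kept k A j).filter fun i : Fin n => Λ ≤ floorRidge k A σ i).card + 1 := by
      exact_mod_cast (Finset.card_le_card hsub).trans (Finset.card_insert_le _ _)
    have h1 := card_filter_kept_mul_le hk hσ0 hσ hΛ j
    have h2 := log_det_one_add_smul_gram_le (rowsOn A (kept k A j)) k hc (sq_nonneg a)
      (quad_kept_le hA j)
    have h3 : tailSq k (rowsOn A (kept k A j)) ≤ 2 * Λ * k := by
      rw [← div_le_iff₀ hk0]
      exact (le_max_left _ _).trans (Finset.mem_filter.1 hjE).2.2.le
    have h4 : Λ⁻¹ * tailSq k (rowsOn A (kept k A j)) ≤ 2 * k := by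
      refine (mul_le_mul_of_nonneg_left h3 hc.le).trans_eq ?_
      field_simp
    rw [potential] at h1
    have h5 := mul_le_mul_of_nonneg_right (sub_le_iff_le_add.2 hcard) hlog
    linarith

theorem card_kept_le (hk : 1 ≤ k) (hn : 2 ≤ n) (hσ0 : 0 < σ) (hσa : σ ≤ a)
    (hσ : PrefixBound k A σ) (hA : ∀ x, (A *ᵥ x) ⬝ᵥ (A *ᵥ x) ≤ a ^ 2 * (x ⬝ᵥ x)) :
    ((kept k A n).card : ℝ) ≤ 300 * (k * Real.log (n * (a / σ)) ^ 2) := by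
  have hn2 : (2 : ℝ) ≤ n := by exact_mod_cast hn
  have hk1 : (1 : ℝ) ≤ k := by exact_mod_cast hk
  have hκ : 1 ≤ a / σ := (one_le_div hσ0).2 hσa
  set N : ℝ := n * (a / σ) with hN
  set L := Real.log N with hL
  have hN2 : 2 ≤ N := by nlinarith
  have hlog2 : 1 / 2 ≤ Real.log 2 := by linarith [Real.log_two_gt_d9]
  have hL2 : 1 / 2 ≤ L := hlog2.trans (Real.log_le_log (by norm_num) hN2)
  have hlog54 : 1 / 5 ≤ Real.log (5 / 4) := by
    have := Real.one_sub_inv_le_log_of_pos (show (0 : ℝ) < 5 / 4 by norm_num)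
    norm_num at this ⊢
    exact this
  set Λ : ℝ := σ ^ 2 / n ^ 2 with hΛ
  have hΛ0 : 0 < Λ := by positivity
  -- From `L ≥ 1/2` one has `1 ≤ k ≤ 2kL`. With `log(5/4) ≥ 1/5` the count is at most `5(3kL + 2k) +
  -- 1 ≤ 35kL + 2kL`.
  have hepoch : ∀ e : ℕ, (((kept k A n).filter fun i : Fin n => 2 ^ e * Λ ≤ floorRidge k A σ i ∧
      floorRidge k A σ i < 2 * (2 ^ e * Λ)).card : ℝ) ≤ 37 * (k * L) := by
    intro e
    have h1 := card_epoch_mul_le hk hσ0 hσ hA (show 0 < 2 ^ e * Λ by positivity)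
    have h2 : Real.log (1 + (2 ^ e * Λ)⁻¹ * a ^ 2) ≤ 3 * L := by
      have e1 : (2 ^ e * Λ)⁻¹ * a ^ 2 ≤ N ^ 2 := by
        have : (2 ^ e * Λ)⁻¹ ≤ Λ⁻¹ :=
          inv_anti₀ hΛ0 (le_mul_of_one_le_left hΛ0.le (one_le_pow₀ (by norm_num)))
        refine (mul_le_mul_of_nonneg_right this (sq_nonneg a)).trans_eq ?_
        rw [hΛ, hN]
        field_simp
      have e2 : 1 + (2 ^ e * Λ)⁻¹ * a ^ 2 ≤ N ^ 3 := by nlinarith [sq_nonneg N]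
      have e3 := Real.log_le_log (by positivity) e2
      rwa [Real.log_pow] at e3
    have h3 := mul_le_mul_of_nonneg_left h2 (show (0 : ℝ) ≤ k by linarith)
    set c := (((kept k A n).filter fun i : Fin n => 2 ^ e * Λ ≤ floorRidge k A σ i ∧
      floorRidge k A σ i < 2 * (2 ^ e * Λ)).card : ℝ)
    have hkL : (k : ℝ) / 2 ≤ k * L := by nlinarith
    by_cases hc : c ≤ 1
    · linarith
    · have h4 : (c - 1) * (1 / 5) ≤ (c - 1) * Real.log (5 / 4) :=
        mul_le_mul_of_nonneg_left hlog54 (by linarith)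
      linarith
  -- The truncated ridge lies between `Λ` and `N³Λ`, so a dyadic exponent satisfies `e log 2 ≤ 3L`,
  -- and `log 2 ≥ 1/2`. Altogether `E ≤ 8L` and `8 · 37 ≤ 300`.
  set E : ℕ := ⌊6 * L⌋₊ + 1 with hE
  have hcover : kept k A n ⊆ (Finset.range E).biUnion fun e =>
      (kept k A n).filter fun i : Fin n => 2 ^ e * Λ ≤ floorRidge k A σ i ∧
        floorRidge k A σ i < 2 * (2 ^ e * Λ) := by
    intro i hi
    have h1 : Λ ≤ floorRidge k A σ i := le_max_right _ _
    obtain ⟨e, he1, he2⟩ := exists_nat_pow_near ((one_le_div hΛ0).2 h1) one_lt_two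
    rw [le_div_iff₀ hΛ0] at he1
    rw [div_lt_iff₀ hΛ0, pow_succ] at he2
    refine Finset.mem_biUnion.2 ⟨e, ?_, Finset.mem_filter.2 ⟨hi, he1, by linarith⟩⟩
    have h2 : floorRidge k A σ i ≤ N ^ 3 * Λ := by
      have e1 : N ^ 3 * Λ = n * (a / σ) * a ^ 2 := by
        rw [hΛ, hN]; field_simp
      refine max_le ?_ (le_mul_of_one_le_left hΛ0.le (one_le_pow₀ (by linarith)))
      rw [e1]
      refine (ridgeAt_le hk hA i).trans (mul_le_mul_of_nonneg_right ?_ (sq_nonneg a))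
      exact le_mul_of_one_le_right (by linarith) hκ
    have h3 : (2 : ℝ) ^ e ≤ N ^ 3 := le_of_mul_le_mul_right (he1.trans h2) hΛ0
    have h4 := Real.log_le_log (by positivity) h3
    rw [Real.log_pow, Real.log_pow] at h4
    have h5 : (e : ℝ) ≤ 6 * L := by
      have := mul_le_mul_of_nonneg_left hlog2 (Nat.cast_nonneg (α := ℝ) e)
      push_cast at h4
      linarith
    exact Finset.mem_range.2 (Nat.lt_succ_of_le (Nat.le_floor h5))
  have h1 : ((kept k A n).card : ℝ) ≤ E * (37 * (k * L)) := by
    have h2 : ((kept k A n).card : ℝ) ≤ ∑ e ∈ Finset.range E,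
        (((kept k A n).filter fun i : Fin n => 2 ^ e * Λ ≤ floorRidge k A σ i ∧
          floorRidge k A σ i < 2 * (2 ^ e * Λ)).card : ℝ) := by
      exact_mod_cast (Finset.card_le_card hcover).trans Finset.card_biUnion_le
    refine h2.trans ((Finset.sum_le_card_nsmul _ _ _ fun e _ => hepoch e).trans_eq ?_)
    rw [Finset.card_range, nsmul_eq_mul]
  have h2 : (E : ℝ) ≤ 8 * L := by
    have := Nat.floor_le (show 0 ≤ 6 * L by linarith)
    rw [hE]
    push_cast
    linarith
  have h3 : 0 ≤ 37 * (k * L) := by positivity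
  have h4 := h1.trans (mul_le_mul_of_nonneg_right h2 h3)
  have h5 : 0 ≤ k * L ^ 2 := by positivity
  linarith

end Counting

/-! ### Distances to a `k`-dimensional subspace -/

section Distance

variable {n d k : ℕ} {A : Matrix (Fin n) (Fin d) ℝ}

theorem maxDist_nonneg (A : Matrix (Fin n) (Fin d) ℝ) (S : Finset (Fin n))
    (V : Submodule ℝ (EuclideanSpace ℝ (Fin d))) : 0 ≤ maxDist A S V :=
  Real.iSup_nonneg fun _ => Metric.infDist_nonneg

theorem infDist_le_maxDist (A : Matrix (Fin n) (Fin d) ℝ) {S : Finset (Fin n)} {i : Fin n}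
    (hi : i ∈ S) (V : Submodule ℝ (EuclideanSpace ℝ (Fin d))) :
    Metric.infDist (WithLp.toLp 2 (A i) : EuclideanSpace ℝ (Fin d)) V ≤ maxDist A S V :=
  le_ciSup (f := fun i : S =>
    Metric.infDist (WithLp.toLp 2 (A i) : EuclideanSpace ℝ (Fin d)) V)
    (Set.finite_range _).bddAbove ⟨i, hi⟩

theorem maxDist_le {S : Finset (Fin n)} {V : Submodule ℝ (EuclideanSpace ℝ (Fin d))} {c : ℝ}
    (hc : 0 ≤ c) (h : ∀ i ∈ S,
      Metric.infDist (WithLp.toLp 2 (A i) : EuclideanSpace ℝ (Fin d)) V ≤ c) :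
    maxDist A S V ≤ c :=
  Real.iSup_le (fun i => h i i.2) hc

theorem maxDist_mono {S T : Finset (Fin n)} (h : S ⊆ T)
    (V : Submodule ℝ (EuclideanSpace ℝ (Fin d))) : maxDist A S V ≤ maxDist A T V :=
  maxDist_le (maxDist_nonneg _ _ _) fun _ hi => infDist_le_maxDist A (h hi) V

theorem infDist_eq_norm_sub_starProjection (V : Submodule ℝ (EuclideanSpace ℝ (Fin d)))
    (x : EuclideanSpace ℝ (Fin d)) :
    Metric.infDist x V = ‖x - V.starProjection x‖ := by
  rw [Submodule.starProjection_minimal, Metric.infDist_eq_iInf]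
  simp only [dist_eq_norm]
  rfl

/-- Projecting the selected rows onto `V` gives a competitor of rank at most `k` whose squared error
is a sum of squared distances. -/
theorem ridgeAt_le_of_finrank {V : Submodule ℝ (EuclideanSpace ℝ (Fin d))}
    (hk : 1 ≤ k) (hV : Module.finrank ℝ V = k) {t : ℕ} (htn : t ≤ n) :
    ridgeAt k A t ≤ (kept k A n).card * maxDist A (kept k A n) V ^ 2 := by
  set X : Matrix (kept k A t) (Fin d) ℝ :=
    of fun i => (V.starProjection (WithLp.toLp 2 (A i))).ofLp with hX
  have hrank : X.rank ≤ k := by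
    rw [rank_eq_finrank_span_row]
    refine le_trans (Submodule.finrank_mono (Submodule.span_le.2 ?_))
      ((LinearEquiv.finrank_map_eq (WithLp.linearEquiv 2 ℝ (Fin d → ℝ)) V).trans hV).le
    rintro _ ⟨i, rfl⟩
    exact ⟨_, Submodule.starProjection_apply_mem V (WithLp.toLp 2 (A i)), rfl⟩
  refine (div_le_self (tailSq_nonneg _ _) (by exact_mod_cast hk)).trans ?_
  refine (tailSq_le hrank).trans ?_
  rw [frobSq_eq_sum]
  refine (Finset.sum_le_card_nsmul Finset.univ _ (maxDist A (kept k A n) V ^ 2)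
    fun i _ => ?_).trans ?_
  · have h1 := norm_sq_eq_dotProduct
      (WithLp.toLp 2 (A i) - V.starProjection (WithLp.toLp 2 (A i)))
    rw [← infDist_eq_norm_sub_starProjection] at h1
    refine h1.symm.le.trans ?_
    exact pow_le_pow_left₀ Metric.infDist_nonneg (infDist_le_maxDist A (kept_mono htn i.2) V) 2
  · rw [nsmul_eq_mul]
    refine mul_le_mul_of_nonneg_right ?_ (sq_nonneg _)
    have := Finset.card_le_card (kept_mono (k := k) (A := A) htn)
    simpa using this

/-- Apply covering to the residual `u` of row `i`. As `u ⟂ V`, each `A j ⬝ᵥ u` sees only the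
residual of row `j`; the selected rows and the ridge term each contribute `|S| D²‖u‖²`, whence the
factor 2. -/
theorem infDist_sq_le {V : Submodule ℝ (EuclideanSpace ℝ (Fin d))}
    (hk : 1 ≤ k) (hV : Module.finrank ℝ V = k) (i : Fin n) :
    Metric.infDist (WithLp.toLp 2 (A i) : EuclideanSpace ℝ (Fin d)) V ^ 2 ≤
      2 * ((kept k A n).card * maxDist A (kept k A n) V ^ 2) := by
  set D := maxDist A (kept k A n) V with hD
  set u : EuclideanSpace ℝ (Fin d) :=
    WithLp.toLp 2 (A i) - V.starProjection (WithLp.toLp 2 (A i)) with hu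
  have huV : u ∈ Vᗮ := Submodule.sub_starProjection_mem_orthogonal _
  have hinner : ∀ j, A j ⬝ᵥ u.ofLp =
      inner ℝ (WithLp.toLp 2 (A j) - V.starProjection (WithLp.toLp 2 (A j))) u := fun j => by
    rw [inner_sub_left, (Submodule.mem_orthogonal V u).1 huV _
      (Submodule.starProjection_apply_mem V _), sub_zero, EuclideanSpace.inner_eq_star_dotProduct,
      dotProduct_comm]
    simp
  have hcover := sq_dotProduct_le_kept (k := k) (A := A) i u.ofLp
  have hq := quad_kept_mono (k := k) (A := A) (show (i : ℕ) + 1 ≤ n from i.2) u.ofLp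
  rw [rowsOn_mulVec_dotProduct_self (S := kept k A n)] at hq
  have hsum : ∑ j ∈ kept k A n, (A j ⬝ᵥ u.ofLp) ^ 2 ≤ (kept k A n).card * (D ^ 2 * ‖u‖ ^ 2) := by
    rw [← nsmul_eq_mul]
    refine Finset.sum_le_card_nsmul _ _ _ fun j hj => ?_
    rw [hinner, ← mul_pow]
    refine sq_le_sq' ?_ ?_
    · refine (neg_le_neg ?_).trans (neg_abs_le _)
      refine (abs_real_inner_le_norm _ _).trans (mul_le_mul_of_nonneg_right ?_ (norm_nonneg _))
      rw [← infDist_eq_norm_sub_starProjection]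
      exact infDist_le_maxDist A hj V
    · refine (real_inner_le_norm _ _).trans (mul_le_mul_of_nonneg_right ?_ (norm_nonneg _))
      rw [← infDist_eq_norm_sub_starProjection]
      exact infDist_le_maxDist A hj V
  have hi : A i ⬝ᵥ u.ofLp = ‖u‖ ^ 2 := by rw [hinner, ← hu, real_inner_self_eq_norm_sq]
  have hlam := ridgeAt_le_of_finrank (A := A) hk hV i.2.le
  rw [hi, ← norm_sq_eq_dotProduct u] at hcover
  have hlam' := mul_le_mul_of_nonneg_right hlam (sq_nonneg ‖u‖)
  rw [infDist_eq_norm_sub_starProjection, ← hu]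
  have hmain : (‖u‖ ^ 2) * (‖u‖ ^ 2) ≤ 2 * ((kept k A n).card * D ^ 2) * ‖u‖ ^ 2 := by
    linarith
  rcases (sq_nonneg ‖u‖).lt_or_eq with h | h
  · exact le_of_mul_le_mul_right hmain h
  · rw [← h]; positivity

end Distance

/-! ### Invariance under reordering the rows -/

section Reindexing

variable {m m' : Type*} [Fintype m] [Fintype m'] {d : ℕ}

theorem frobSq_submatrix_equiv (M : Matrix m (Fin d) ℝ) (e : m' ≃ m) :
    frobSq (M.submatrix e id) = frobSq M :=
  e.sum_comp fun i => ∑ j, M i j ^ 2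

theorem tailSq_submatrix_le (k : ℕ) (M : Matrix m (Fin d) ℝ) (e : m' ≃ m) :
    tailSq k (M.submatrix e id) ≤ tailSq k M := by
  refine le_tailSq fun X hX => ?_
  rw [← frobSq_submatrix_equiv _ e]
  refine tailSq_le (X := X.submatrix e id) ?_
  exact (rank_submatrix X e (Equiv.refl (Fin d))).trans_le hX

theorem tailSq_submatrix_equiv (k : ℕ) (M : Matrix m (Fin d) ℝ) (e : m' ≃ m) :
    tailSq k (M.submatrix e id) = tailSq k M := by
  refine le_antisymm (tailSq_submatrix_le k M e) ?_
  have := tailSq_submatrix_le k (M.submatrix e id) e.symm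
  simpa using this

omit [Fintype m] [Fintype m'] in
theorem rowspace_submatrix_equiv (M : Matrix m (Fin d) ℝ) (e : m' ≃ m) :
    rowspace (M.submatrix e id) = rowspace M :=
  congrArg (Submodule.span ℝ) (e.surjective.range_comp M.row)

theorem ridgeScore_submatrix_equiv (M : Matrix m (Fin d) ℝ) (e : m' ≃ m) (lam : ℝ)
    (a : Fin d → ℝ) : ridgeScore (M.submatrix e id) lam a = ridgeScore M lam a := by
  have h : (M.submatrix e id)ᵀ * M.submatrix e id = Mᵀ * M := by
    rw [transpose_submatrix, submatrix_mul_equiv, submatrix_id_id]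
  rw [ridgeScore, ridgeScore, h]

theorem accepts_submatrix_equiv (k : ℕ) (M : Matrix m (Fin d) ℝ) (e : m' ≃ m) (a : Fin d → ℝ) :
    Accepts k (M.submatrix e id) a ↔ Accepts k M a := by
  rw [Accepts, Accepts, tailSq_submatrix_equiv, rowspace_submatrix_equiv,
    ridgeScore_submatrix_equiv]

end Reindexing

/-! ### The memory trace realises the abstract selection -/

section Run

variable {n d k : ℕ} {A : Matrix (Fin n) (Fin d) ℝ}

/-- The memory `m` holds exactly the rows of `A` with index in `S`, and the right ridge
parameter. -/
structure Represents (k : ℕ) (A : Matrix (Fin n) (Fin d) ℝ) (S : Finset (Fin n))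
    (m : Memory n d) : Prop where
  nodup : (m.stored.map Prod.fst).Nodup
  labels : (m.stored.map Prod.fst).toFinset = S
  rows : ∀ p ∈ m.stored, p.2 = A p.1
  ridge_eq : m.ridge = tailSq k m.matrix / k

/-- Distinct labels make list positions correspond bijectively to `S`, so the stored matrix differs
from `rowsOn A S` only in the indexing of its rows, which the selection rule does not see. -/
theorem exists_matrix_eq_submatrix {S : Finset (Fin n)} {m : Memory n d}
    (hnd : (m.stored.map Prod.fst).Nodup) (hS : (m.stored.map Prod.fst).toFinset = S)
    (hrows : ∀ p ∈ m.stored, p.2 = A p.1) :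
    ∃ e : Fin m.stored.length ≃ S, m.matrix = (rowsOn A S).submatrix e id := by
  have hmem : ∀ i, (m.stored.get i).1 ∈ S := fun i => by
    rw [← hS, List.mem_toFinset]
    exact List.mem_map_of_mem (List.get_mem _ _)
  let f : Fin m.stored.length → S := fun i => ⟨(m.stored.get i).1, hmem i⟩
  have hf : Function.Bijective f := by
    constructor
    · intro i j hij
      have h : (m.stored.get i).1 = (m.stored.get j).1 := congrArg Subtype.val hij
      have := (List.nodup_iff_injective_get.1 hnd)
        (a₁ := ⟨i, by simp⟩) (a₂ := ⟨j, by simp⟩) (by simpa using h)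
      exact Fin.ext (by simpa using this)
    · rintro ⟨s, hs⟩
      rw [← hS, List.mem_toFinset, List.mem_map] at hs
      obtain ⟨p, hp, rfl⟩ := hs
      obtain ⟨i, hi⟩ := List.get_of_mem hp
      exact ⟨i, Subtype.ext (congrArg Prod.fst hi)⟩
  refine ⟨Equiv.ofBijective f hf, ?_⟩
  ext i j
  exact congrFun (hrows _ (List.get_mem m.stored i)) j

open Classical in
theorem foldl_exec_block (m : Memory n d) (hm : m.ridge = tailSq k m.matrix / k)
    (x : Fin n × (Fin d → ℝ)) :
    ([Instr.read x, Instr.select, Instr.update].foldl (exec k) m).stored =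
        (if Accepts k m.matrix x.2 then m.stored ++ [x] else m.stored) ∧
      ([Instr.read x, Instr.select, Instr.update].foldl (exec k) m).ridge =
        tailSq k ([Instr.read x, Instr.select, Instr.update].foldl (exec k) m).matrix / k := by
  refine ⟨?_, rfl⟩
  have key : ([Instr.read x, Instr.select, Instr.update].foldl (exec k) m).stored =
      (if m.ridge = 0 ∧ x.2 ∉ rowspace m.matrix then
          (⟨m.stored ++ [x], m.ridge, some x⟩ : Memory n d)
        else if 1 / (1 + 1 / (k : ℝ)) ≤ ridgeScore m.matrix m.ridge x.2 then
          ⟨m.stored ++ [x], m.ridge, some x⟩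
        else ⟨m.stored, m.ridge, some x⟩).stored := rfl
  rw [key, Accepts, ← hm]
  by_cases h1 : m.ridge = 0 ∧ x.2 ∉ rowspace m.matrix
  · rw [if_pos h1, if_pos (Or.inl h1)]
  · by_cases h2 : 1 / (1 + 1 / (k : ℝ)) ≤ ridgeScore m.matrix m.ridge x.2
    · rw [if_neg h1, if_pos h2, if_pos (Or.inr h2)]
    · rw [if_neg h1, if_neg h2, if_neg (not_or.2 ⟨h1, h2⟩)]

theorem Represents.block {t : Fin n} {m : Memory n d} (h : Represents k A (kept k A t) m) :
    Represents k A (kept k A (t + 1))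
      ([Instr.read (t, A t), Instr.select, Instr.update].foldl (exec k) m) := by
  obtain ⟨hst, hr⟩ := foldl_exec_block m h.ridge_eq (t, A t)
  obtain ⟨e, he⟩ := exists_matrix_eq_submatrix h.nodup h.labels h.rows
  have hacc : Accepts k m.matrix (A t) ↔ Accepts k (rowsOn A (kept k A t)) (A t) := by
    rw [he, accepts_submatrix_equiv]
  set m' := [Instr.read (t, A t), Instr.select, Instr.update].foldl (exec k) m
  by_cases hc : Accepts k (rowsOn A (kept k A t)) (A t)
  · rw [if_pos (hacc.2 hc)] at hst
    have hnot : t ∉ m.stored.map Prod.fst := fun hmem => by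
      rw [← List.mem_toFinset, h.labels] at hmem
      exact lt_irrefl _ (lt_of_mem_kept hmem)
    refine ⟨?_, ?_, ?_, hr⟩
    · rw [hst, List.map_append, List.nodup_append]
      refine ⟨h.nodup, by simp, ?_⟩
      rintro a ha b hb rfl
      simp only [List.map_cons, List.map_nil, List.mem_singleton] at hb
      exact hnot (hb ▸ ha)
    · rw [kept_succ_of_accepts t hc, ← h.labels, hst, List.map_append, List.toFinset_append]
      ext; simp
    · rw [hst]
      intro p hp
      rcases List.mem_append.1 hp with hp | hp
      · exact h.rows p hp
      · rw [List.mem_singleton.1 hp]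
  · rw [if_neg (fun h' => hc (hacc.1 h'))] at hst
    refine ⟨?_, ?_, ?_, hr⟩
    · rw [hst]; exact h.nodup
    · rw [hst, kept_succ_of_not_accepts t hc]; exact h.labels
    · rw [hst]; exact h.rows

theorem represents_init : Represents k A ∅ (Memory.init n d) := by
  refine ⟨List.nodup_nil, rfl, by simp [Memory.init], ?_⟩
  rw [tailSq_eq_zero, zero_div]
  · rfl
  · exact (rank_le_card_height _).trans ((Fintype.card_fin 0).trans_le (Nat.zero_le k))

theorem represents_take (t : ℕ) (ht : t ≤ n) :
    Represents k A (kept k A t)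
      (((List.ofFn fun t : Fin n => [Instr.read (t, A t), Instr.select, Instr.update]).take
        t).flatten.foldl (exec k) (Memory.init n d)) := by
  induction t with
  | zero => exact represents_init
  | succ t ih =>
    rw [List.take_succ_eq_append_getElem (by simpa using ht), List.flatten_append,
      List.foldl_append, List.getElem_ofFn]
    simp only [List.flatten_singleton]
    exact (ih (by omega)).block (t := ⟨t, ht⟩)

theorem represents_final (k : ℕ) (A : Matrix (Fin n) (Fin d) ℝ) :
    Represents k A (kept k A n) ((program A).foldl (exec k) (Memory.init n d)) := by
  have h := represents_take (k := k) (A := A) n le_rfl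
  rwa [List.take_of_length_le (by simp)] at h

theorem selected_eq_kept (k : ℕ) (A : Matrix (Fin n) (Fin d) ℝ) : selected k A = kept k A n :=
  (represents_final k A).labels

theorem stored_length_le_exec (m : Memory n d) (c : Instr n d) :
    m.stored.length ≤ (exec k m c).stored.length := by
  cases c with
  | read x => exact le_rfl
  | update => exact le_rfl
  | select =>
    simp only [exec]
    split
    · exact le_rfl
    · split_ifs <;> simp

theorem stored_length_le_foldl (l : List (Instr n d)) (m : Memory n d) :
    m.stored.length ≤ (l.foldl (exec k) m).stored.length := by
  induction l generalizing m with
  | nil => exact le_rfl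
  | cons c l ih => exact (stored_length_le_exec m c).trans (ih _)

theorem stored_length_le_card_selected {m : Memory n d} (hm : m ∈ trace k A) :
    m.stored.length ≤ (selected k A).card := by
  obtain ⟨j, hj, rfl⟩ := List.mem_iff_getElem.1 hm
  have hfin : (selected k A).card =
      ((program A).foldl (exec k) (Memory.init n d)).stored.length := by
    rw [selected, List.toFinset_card_of_nodup (represents_final k A).nodup, List.length_map]
  rw [hfin]
  simp only [trace, List.getElem_scanl]
  conv_rhs => rw [← List.take_append_drop j (program A), List.foldl_append]
  exact stored_length_le_foldl _ _

/-- If nothing were selected, the ridge parameter would stay zero and covering, tested on each row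
itself, would make that row vanish. -/
theorem kept_nonempty (hA : A ≠ 0) : (kept k A n).Nonempty := by
  by_contra h
  rw [Finset.not_nonempty_iff_eq_empty] at h
  refine hA (funext fun i => ?_)
  have hempty : ∀ t ≤ n, kept k A t = ∅ := fun t ht =>
    Finset.subset_empty.1 (h ▸ kept_mono ht)
  have h1 := sq_dotProduct_le_kept (k := k) (A := A) i (A i)
  have h2 : ridgeAt k A i = 0 := by
    rw [ridgeAt, tailSq_eq_zero, zero_div]
    refine (rank_le_card_height _).trans ?_
    rw [Fintype.card_coe, hempty i i.2.le]
    simp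
  rw [h2, rowsOn_mulVec_dotProduct_self, hempty (i + 1) i.2, Finset.sum_empty, zero_mul,
    add_zero] at h1
  exact dotProduct_self_eq_zero.1 (pow_eq_zero_iff two_ne_zero |>.1 (le_antisymm h1 (sq_nonneg _)))

end Run

end RidgeCoreset

/-! ### The main theorem -/

theorem mainTheorem1 :
    ∃ C : ℝ, 0 < C ∧
      ∀ (n d k : ℕ), 2 ≤ n → 1 ≤ k → k ≤ d →
      ∀ A : Matrix (Fin n) (Fin d) ℝ, A ≠ 0 →
        (RidgeCoreset.selected k A).Nonempty ∧
        ((RidgeCoreset.selected k A).card : ℝ) ≤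
          C * (k * Real.log (n * RidgeCoreset.onlineCond k A) ^ 2) ∧
        (∀ V : Submodule ℝ (EuclideanSpace ℝ (Fin d)), Module.finrank ℝ V = k →
          RidgeCoreset.maxDist A (RidgeCoreset.selected k A) V ≤
            RidgeCoreset.maxDist A Finset.univ V ∧
          RidgeCoreset.maxDist A Finset.univ V ≤
            C * (√(k : ℝ) * Real.log (n * RidgeCoreset.onlineCond k A)) *
              RidgeCoreset.maxDist A (RidgeCoreset.selected k A) V) ∧
        (∀ m ∈ RidgeCoreset.trace k A,
          (m.words : ℝ) ≤ C * ((RidgeCoreset.selected k A).card * d)) := by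
  refine ⟨300, by norm_num, fun n d k hn hk hkd A hA => ?_⟩
  obtain ⟨a, σ, hσ0, hσa, hκ, hop, hσ⟩ := RidgeCoreset.exists_onlineCond_eq hk hA
  have hcard := RidgeCoreset.card_kept_le hk hn hσ0 hσa hσ hop
  have hne := RidgeCoreset.kept_nonempty (k := k) hA
  have hspace := fun m (hm : m ∈ RidgeCoreset.trace k A) =>
    RidgeCoreset.stored_length_le_card_selected hm
  rw [RidgeCoreset.selected_eq_kept] at hspace ⊢
  rw [hκ]
  refine ⟨hne, hcard, fun V hV => ⟨RidgeCoreset.maxDist_mono (Finset.subset_univ _) V, ?_⟩,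
    fun m hm => ?_⟩
  · set D := RidgeCoreset.maxDist A (RidgeCoreset.kept k A n) V with hD
    have hD0 : 0 ≤ D := RidgeCoreset.maxDist_nonneg _ _ _
    set L := Real.log (n * (a / σ)) with hL
    have hL0 : 0 ≤ L := Real.log_nonneg (one_le_mul_of_one_le_of_one_le
      (by exact_mod_cast (by omega : 1 ≤ n)) ((one_le_div hσ0).2 hσa))
    have hR : 0 ≤ 300 * (√(k : ℝ) * L) * D := by positivity
    refine RidgeCoreset.maxDist_le hR fun i _ => ?_
    refine le_of_sq_le_sq ((RidgeCoreset.infDist_sq_le hk hV i).trans ?_) hR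
    have hk' : √(k : ℝ) ^ 2 = k := Real.sq_sqrt (Nat.cast_nonneg k)
    have h1 := mul_le_mul_of_nonneg_right hcard (sq_nonneg D)
    have h2 : 0 ≤ k * L ^ 2 * D ^ 2 := by positivity
    -- The row-count constant serves here too: `2 · 300 ≤ 300²`.
    calc 2 * (((RidgeCoreset.kept k A n).card : ℝ) * D ^ 2)
        ≤ 2 * (300 * (k * L ^ 2) * D ^ 2) := by linarith
      _ ≤ 90000 * (k * L ^ 2 * D ^ 2) := by linarith
      _ = (300 * (√(k : ℝ) * L) * D) ^ 2 := by
        rw [mul_pow, mul_pow, mul_pow, hk']; ring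
  · have hs := hspace m hm
    have hd : 1 ≤ d := hk.trans hkd
    have hc : 1 ≤ (RidgeCoreset.kept k A n).card := hne.card_pos
    have hbuf : m.buffer.elim 0 (fun _ => d + 1) ≤ d + 1 := by
      cases m.buffer <;> simp
    -- Labels, ridge parameter and buffer are absorbed because `|S| ≥ 1` and `d ≥ 1`.
    have hw : m.words ≤ 300 * ((RidgeCoreset.kept k A n).card * d) := by
      rw [RidgeCoreset.Memory.words]
      have h1 := Nat.mul_le_mul_right (d + 1) hs
      nlinarith [Nat.mul_le_mul hc hd]
    exact_mod_cast hw
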